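/- Let $G$ be a finite, simple, connected graph of maximum degree $3$ that is not isomorphic to the Petersen graph. Let $\gamma(G)$ be the largest fraction of the edges of $G$ that can be properly coloured with three colours, that is, the maximum of $|E(H)|/|E(G)|$ over all subgraphs $H$ of $G$ that admit a proper edge-colouring with three colours (any two distinct edges of $H$ with a common end receive different colours). Let $g_{odd}(G)$ be the odd girth of $G$, that is, the length of a shortest cycle of odd length in $G$, with $g_{odd}(G)=\infty$ if $G$ has no odd cycle. Then $$\gamma(G)\;\geq\;1-\frac{2}{3\,g_{odd}(G)+2},$$ where for $g_{odd}(G)=\infty$ the right-hand side is read as $1$, so that $\gamma(G)=1$ in that case. In particular, $\gamma(G)\geq \frac{15}{17}$ whenever $g_{odd}(G)\geq 5$. -/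

import Mathlib

/-- The odd girth of a graph: the length of a shortest cycle of odd length, and `⊤` if the graph
has no cycle of odd length (that is, if it is bipartite). -/
noncomputable def oddGirth {V : Type*} (G : SimpleGraph V) : ℕ∞ :=
  ⨅ (a : V) (w : G.Walk a a) (_ : w.IsCycle) (_ : Odd w.length), (w.length : ℕ∞)

/-- A graph is `k`-edge-colourable if its edges can be given `k` colours in such a way that any two
distinct edges with a common end receive different colours, that is, if its line graph is
`k`-colourable. -/
def EdgeColorable {V : Type*} (H : SimpleGraph V) (k : ℕ) : Prop :=
  H.lineGraph.Colorable k

/-- The largest number of edges in a 3-edge-colourable spanning subgraph of a finite graph `G`. -/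
noncomputable def maxThreeColoredEdges {V : Type*} [Finite V] (G : SimpleGraph V) : ℕ :=
  sSup {n : ℕ | ∃ H : SimpleGraph V, H ≤ G ∧ EdgeColorable H 3 ∧ H.edgeSet.ncard = n}

/-- The largest fraction of the edges of a finite graph `G` that can be properly coloured
with three colours. -/
noncomputable def coloredFraction {V : Type*} [Finite V] (G : SimpleGraph V) : ℝ :=
  (maxThreeColoredEdges G : ℝ) / (G.edgeSet.ncard : ℝ)

/-- The Petersen graph: its vertices are the 2-element subsets of a 5-element set, two of them
being adjacent when they are disjoint. -/
def petersenGraph : SimpleGraph {s : Finset (Fin 5) // s.card = 2} where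
  Adj s t := Disjoint s.1 t.1
  symm := ⟨fun _ _ h => h.symm⟩
  loopless := ⟨fun s h => by
    have h0 : s.1 = ∅ := by simpa using h
    have h2 := s.2
    simp [h0] at h2⟩

/-!
The bound is proved for partial proper colourings `c` of the edges with three colours: the edges
coloured by `c` form a 3-edge-colourable subgraph, so it suffices to find a colouring with at most
`2 |E| / (3 g + 2)` uncoloured edges, where `g` is the odd girth.

Let `c` have as few uncoloured edges as possible. The ends `x` and `y` of an uncoloured edge miss
colours `p` and `q`, and by a Kempe change a chain in these two colours joins `x` and `y`; with `xy`
it forms an alternating cycle of odd length (`IsOptimal.exists_alternating`). The uncoloured edge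
can be moved to any place of this cycle (`Alternating.rotate`), and the alternating cycles of
different uncoloured edges are disjoint (`Alternating.disjoint`). In a graph without odd cycles
there is therefore no uncoloured edge at all. In general, an alternating cycle of length `L` whose
vertices have degree three contributes `3 L` to the degree sum `2 |E|`, and so the
disjointness gives almost the bound; what is missing are two units for every cycle of
length `g`, and compensation for the vertices of degree two.

These come from the edges by which vertices outside all the cycles are joined to them
(`entering`). If an alternating cycle contains a vertex of degree two, then `c` can be chosen such
that its uncoloured edge has an end of degree two. This edge then lies on a second alternating
cycle in another pair of colours, which has sufficiently many vertices that are not on the first one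
(`Alternating.exists_second_card`). For the other cycles, suppose that two alternating cycles are
joined by an edge `ab`. One can move the uncoloured edges next to `a` and `b` and recolour `ab`, and
the disjointness of the alternating cycles of the new colouring shows that vertices next to `a`
cannot be joined to a third alternating cycle, nor to `b` or a neighbour of `b` on its cycle
(`Alternating.switch`, `Alternating.next_to_edge`). Hence a cycle of length `g` that lacks
entering edges is joined, with at most one exception, at all its vertices to one and the same
partner cycle (`CycleSystem.Tight.exists_partner`). If the partner has length `g` as well, then the
steps of the joining edges along the partner force `g = 5`, and if moreover `c` maximises the
total length of the alternating cycles, the two pentagons form the Petersen graph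
(`CycleSystem.Tight.petersen`). Otherwise the partner is longer, and it is long enough to give two
units to every cycle whose partner it is (`CycleSystem.card_mul_le_length`, `discharge_long`).
The balance is drawn up in `IsExtremal.card_mul_le`.
-/

set_option linter.unusedSectionVars false

/-! ### Partial colourings and Kempe changes -/

namespace ThreeColoring

variable {V : Type*} [Fintype V] [DecidableEq V] (G : SimpleGraph V) [DecidableRel G.Adj]

/-- A partial colouring of the unordered pairs by three colours is proper on `G` if two edges of
`G` with a common end never carry the same colour; `none` marks uncoloured edges. -/
def IsProper (c : Sym2 V → Option (Fin 3)) : Prop :=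
  ∀ ⦃v w w' : V⦄ ⦃k : Fin 3⦄, G.Adj v w → G.Adj v w' →
    c s(v, w) = some k → c s(v, w') = some k → w = w'

/-- The set of edges of `G` left uncoloured by `c`. -/
def uncolored (c : Sym2 V → Option (Fin 3)) : Finset (Sym2 V) :=
  G.edgeFinset.filter fun e => c e = none

/-- A proper partial colouring is optimal, or minimal, if it leaves as few edges uncoloured as
possible. -/
def IsOptimal (c : Sym2 V → Option (Fin 3)) : Prop :=
  IsProper G c ∧ ∀ c', IsProper G c' → (uncolored G c).card ≤ (uncolored G c').card

/-- No edge of `G` at `v` has the colour `k`. -/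
def Missing (c : Sym2 V → Option (Fin 3)) (v : V) (k : Fin 3) : Prop :=
  ∀ w, G.Adj v w → c s(v, w) ≠ some k

variable {G} {c : Sym2 V → Option (Fin 3)}

lemma mem_uncolored {e : Sym2 V} : e ∈ uncolored G c ↔ e ∈ G.edgeSet ∧ c e = none := by
  simp [uncolored]

lemma mem_uncolored_mk {x y : V} : s(x, y) ∈ uncolored G c ↔ G.Adj x y ∧ c s(x, y) = none := by
  simp [uncolored]

lemma exists_isOptimal : ∃ c, IsOptimal G c := by
  have hne : {c : Sym2 V → Option (Fin 3) | IsProper G c}.Nonempty :=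
    ⟨fun _ => none, fun _ _ _ _ _ _ h => by simp at h⟩
  obtain ⟨c, hc, hmin⟩ := Set.exists_min_image _ (fun c => (uncolored G c).card)
    (Set.toFinite {c : Sym2 V → Option (Fin 3) | IsProper G c}) hne
  exact ⟨c, hc, hmin⟩

lemma IsOptimal.of_card_eq {c' : Sym2 V → Option (Fin 3)} (hc : IsOptimal G c) (h' : IsProper G c')
    (hcard : (uncolored G c').card = (uncolored G c).card) : IsOptimal G c' :=
  ⟨h', fun c'' h'' => hcard ▸ hc.2 c'' h''⟩

/-- Recolouring an edge by a colour missing at both ends keeps the colouring proper. -/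
lemma IsProper.update (hc : IsProper G c) {x y : V} {k : Fin 3}
    (hx : Missing G c x k) (hy : Missing G c y k) :
    IsProper G (Function.update c s(x, y) (some k)) := by
  intro v w w' l hw hw' h h'
  by_cases h1 : s(v, w) = s(x, y)
  · by_cases h2 : s(v, w') = s(x, y)
    · exact Sym2.congr_right.1 (h1.trans h2.symm)
    · rw [h1, Function.update_self] at h
      rw [Function.update_of_ne h2] at h'
      cases h
      rcases Sym2.eq_iff.1 h1 with ⟨rfl, rfl⟩ | ⟨rfl, rfl⟩
      · exact absurd h' (hx _ hw')
      · exact absurd h' (hy _ hw')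
  · by_cases h2 : s(v, w') = s(x, y)
    · rw [h2, Function.update_self] at h'
      rw [Function.update_of_ne h1] at h
      cases h'
      rcases Sym2.eq_iff.1 h2 with ⟨rfl, rfl⟩ | ⟨rfl, rfl⟩
      · exact absurd h (hx _ hw)
      · exact absurd h (hy _ hw)
    · rw [Function.update_of_ne h1] at h
      rw [Function.update_of_ne h2] at h'
      exact hc hw hw' h h'

/-- In a minimal colouring no colour is missing at both ends of an uncoloured edge. -/
lemma IsOptimal.not_missing (hc : IsOptimal G c) {x y : V} {k : Fin 3} (hxy : G.Adj x y)
    (hn : c s(x, y) = none) (hx : Missing G c x k) : ¬ Missing G c y k := by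
  intro hy
  have h := hc.2 _ (hc.1.update hx hy)
  have hlt : uncolored G (Function.update c s(x, y) (some k)) ⊂ uncolored G c := by
    refine (Finset.ssubset_iff_of_subset ?_).2 ⟨s(x, y), mem_uncolored_mk.2 ⟨hxy, hn⟩, ?_⟩
    · intro e he
      rw [mem_uncolored] at he ⊢
      rcases eq_or_ne e s(x, y) with rfl | hne
      · exact ⟨he.1, hn⟩
      · rw [Function.update_of_ne hne] at he
        exact he
    · simp [mem_uncolored]
  exact absurd (Finset.card_lt_card hlt) (not_lt.2 h)

lemma eq_or_eq_or_eq_of_degree_le {v a b d w : V} (hd : G.degree v ≤ 3) (ha : G.Adj v a)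
    (hb : G.Adj v b) (hd' : G.Adj v d) (hab : a ≠ b) (had : a ≠ d) (hbd : b ≠ d)
    (hw : G.Adj v w) : w = a ∨ w = b ∨ w = d := by
  by_contra! h
  have hsub : ({w, a, b, d} : Finset V) ⊆ G.neighborFinset v := by
    intro u hu
    simp only [Finset.mem_insert, Finset.mem_singleton] at hu
    rcases hu with rfl | rfl | rfl | rfl <;> simpa
  have hcard : ({w, a, b, d} : Finset V).card = 4 := by
    rw [Finset.card_insert_of_notMem (by simp [h]), Finset.card_insert_of_notMem (by simp [hab, had]),
      Finset.card_insert_of_notMem (by simp [hbd]), Finset.card_singleton]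
  have := Finset.card_le_card hsub
  rw [hcard, G.card_neighborFinset_eq_degree] at this
  omega

/-- A vertex of degree at most three on an uncoloured edge misses a colour. -/
lemma exists_missing {x y : V} (hd : G.degree x ≤ 3) (hxy : G.Adj x y)
    (hn : c s(x, y) = none) : ∃ k, Missing G c x k := by
  by_contra! h
  simp only [Missing, not_forall, not_not] at h
  choose w hw hcw using h
  have hne : ∀ k l, k ≠ l → w k ≠ w l := by
    intro k l hkl he
    have := hcw k
    rw [he, hcw l] at this
    exact hkl (Option.some.inj this).symm
  rcases eq_or_eq_or_eq_of_degree_le hd (hw 0) (hw 1) (hw 2) (hne _ _ (by decide))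
    (hne _ _ (by decide)) (hne _ _ (by decide)) hxy with rfl | rfl | rfl
  · simp [hcw] at hn
  · simp [hcw] at hn
  · simp [hcw] at hn

/-- The Kempe change: exchange the colours `p` and `q` on all edges that meet the set `K`. -/
noncomputable def kempe (c : Sym2 V → Option (Fin 3)) (K : Set V) (p q : Fin 3) :
    Sym2 V → Option (Fin 3) :=
  open Classical in fun e => if ∃ v ∈ e, v ∈ K then (c e).map (Equiv.swap p q) else c e

lemma kempe_of_mem {K : Set V} {p q : Fin 3} {v w : V} (hv : v ∈ K) :
    kempe c K p q s(v, w) = (c s(v, w)).map (Equiv.swap p q) := by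
  unfold kempe
  rw [if_pos ⟨v, by simp, hv⟩]

lemma kempe_of_notMem {K : Set V} {p q : Fin 3}
    (hK : ∀ v w, G.Adj v w → c s(v, w) = some p ∨ c s(v, w) = some q → v ∈ K → w ∈ K)
    {v w : V} (hv : v ∉ K) (hvw : G.Adj v w) :
    kempe c K p q s(v, w) = c s(v, w) := by
  unfold kempe
  split_ifs with h
  · have hw : w ∈ K := by
      obtain ⟨u, hu, huK⟩ := h
      rcases Sym2.mem_iff.1 hu with rfl | rfl
      · exact absurd huK hv
      · exact huK
    have hnot : ¬ (c s(v, w) = some p ∨ c s(v, w) = some q) := fun hpq =>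
      hv (hK w v hvw.symm (by rwa [Sym2.eq_swap]) hw)
    push Not at hnot
    cases hcv : c s(v, w) with
    | none => rfl
    | some k =>
      rw [hcv] at hnot
      simp only [Option.map_some, Option.some.injEq]
      exact Equiv.swap_apply_of_ne_of_ne (fun h => hnot.1 (by rw [h])) (fun h => hnot.2 (by rw [h]))
  · rfl

lemma uncolored_kempe {K : Set V} {p q : Fin 3} :
    uncolored G (kempe c K p q) = uncolored G c := by
  ext e
  simp only [mem_uncolored, kempe]
  split_ifs <;> simp

lemma IsOptimal.kempe {K : Set V} {p q : Fin 3} (hc : IsOptimal G c)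
    (hK : ∀ v w, G.Adj v w → c s(v, w) = some p ∨ c s(v, w) = some q → v ∈ K → w ∈ K) :
    IsOptimal G (kempe c K p q) := by
  refine hc.of_card_eq ?_ (by rw [uncolored_kempe])
  intro v w w' k hw hw' h h'
  by_cases hv : v ∈ K
  · rw [kempe_of_mem hv, Option.map_eq_some_iff] at h h'
    obtain ⟨a, ha, hak⟩ := h
    obtain ⟨b, hb, hbk⟩ := h'
    have : a = b := (Equiv.swap p q).injective (hak.trans hbk.symm)
    subst this
    exact hc.1 hw hw' ha hb
  · rw [kempe_of_notMem hK hv hw] at h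
    rw [kempe_of_notMem hK hv hw'] at h'
    exact hc.1 hw hw' h h'

/-- The subgraph formed by the edges of the colours `p` and `q`. -/
def twoColorGraph (G : SimpleGraph V) (c : Sym2 V → Option (Fin 3)) (p q : Fin 3) :
    SimpleGraph V where
  Adj v w := G.Adj v w ∧ (c s(v, w) = some p ∨ c s(v, w) = some q)
  symm := ⟨fun v w h => ⟨h.1.symm, by rw [Sym2.eq_swap]; exact h.2⟩⟩
  loopless := ⟨fun _ h => G.loopless.irrefl _ h.1⟩

/-- The Kempe chain argument: in a minimal colouring, if `p` is missing at one end of an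
uncoloured edge and `q` at the other, then a `p`-`q`-chain joins the two ends. -/
lemma IsOptimal.reachable (hc : IsOptimal G c) {x y : V} {p q : Fin 3} (hxy : G.Adj x y)
    (hn : c s(x, y) = none) (hx : Missing G c x p) (hy : Missing G c y q) :
    (twoColorGraph G c p q).Reachable x y := by
  by_contra hr
  let K : Set V := {v | (twoColorGraph G c p q).Reachable x v}
  have hK : ∀ v w, G.Adj v w → c s(v, w) = some p ∨ c s(v, w) = some q → v ∈ K → w ∈ K := by
    intro v w hvw h hv
    have : (twoColorGraph G c p q).Adj v w := ⟨hvw, h⟩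
    exact SimpleGraph.Reachable.trans hv this.reachable
  have hxK : x ∈ K := SimpleGraph.Reachable.refl x
  have hyK : y ∉ K := hr
  refine (hc.kempe hK).not_missing (k := q) hxy ?_ ?_ ?_
  · rw [kempe_of_mem hxK, hn]; rfl
  · intro w hw h
    rw [kempe_of_mem hxK, Option.map_eq_some_iff] at h
    obtain ⟨a, ha, haq⟩ := h
    have : a = p := by
      apply (Equiv.swap p q).injective
      rw [haq, Equiv.swap_apply_left]
    exact hx w hw (by rw [ha, this])
  · intro w hw h
    rw [kempe_of_notMem hK hyK hw] at h
    exact hy w hw h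

end ThreeColoring

/-! ### Odd cycles and alternating cycles -/

namespace ThreeColoring

open Function

/-- A cycle of odd length in `G`, given by an injective parametrisation of its vertices by the
integers modulo its length. -/
structure OddCycle {V : Type*} (G : SimpleGraph V) where
  L : ℕ
  z : ZMod L → V
  odd : Odd L
  three_le : 3 ≤ L
  inj : Injective z
  adj : ∀ i, G.Adj (z i) (z (i + 1))

section ZModFacts

variable {L : ℕ}

lemma zmod_natCast_ne_zero {n : ℕ} (h0 : 0 < n) (hn : n < L) : (n : ZMod L) ≠ 0 := by
  intro h
  rw [ZMod.natCast_eq_zero_iff] at h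
  exact absurd (Nat.le_of_dvd h0 h) (by omega)

lemma zmod_one_ne_zero (hL : 3 ≤ L) : (1 : ZMod L) ≠ 0 := by
  simpa using zmod_natCast_ne_zero (L := L) (n := 1) (by omega) (by omega)

lemma zmod_two_ne_zero (hL : 3 ≤ L) : (2 : ZMod L) ≠ 0 := by
  simpa using zmod_natCast_ne_zero (L := L) (n := 2) (by omega) (by omega)

lemma zmod_val_add_one (hL : 3 ≤ L) (i : ZMod L) (h : i + 1 ≠ 0) : (i + 1).val = i.val + 1 := by
  have : NeZero L := ⟨by omega⟩
  have : Fact (1 < L) := ⟨by omega⟩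
  have h1 : (1 : ZMod L).val = 1 := ZMod.val_one L
  have hlt := ZMod.val_lt i
  by_cases hs : i.val + 1 < L
  · rw [ZMod.val_add_of_lt (by rw [h1]; exact hs), h1]
  · exfalso
    apply h
    have : i.val + 1 = L := by omega
    have h2 : ((i.val + 1 : ℕ) : ZMod L) = 0 := by rw [this]; simp
    simpa using h2

end ZModFacts

namespace OddCycle

variable {V : Type*} {G : SimpleGraph V} (C : OddCycle G)

instance : NeZero C.L := ⟨by have := C.three_le; omega⟩

lemma add_one_ne (i : ZMod C.L) : i + 1 ≠ i := by
  simpa using zmod_one_ne_zero C.three_le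

lemma add_one_ne_sub_one (i : ZMod C.L) : i + 1 ≠ i - 1 := by
  intro h
  apply zmod_two_ne_zero C.three_le
  linear_combination h

lemma adj_sub (i : ZMod C.L) : G.Adj (C.z i) (C.z (i - 1)) := by
  have := C.adj (i - 1)
  rw [sub_add_cancel] at this
  exact this.symm

lemma z_succ_ne_pred (i : ZMod C.L) : C.z (i + 1) ≠ C.z (i - 1) :=
  C.inj.ne (C.add_one_ne_sub_one i)

/-- The `i`-th edge of the cycle joins its `i`-th vertex to the next one. -/
def edge (i : ZMod C.L) : Sym2 V := s(C.z i, C.z (i + 1))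

lemma edge_mem (i : ZMod C.L) : C.edge i ∈ G.edgeSet := C.adj i

lemma edge_injective : Injective C.edge := by
  intro i k h
  rcases Sym2.eq_iff.1 h with ⟨h1, -⟩ | ⟨h1, h2⟩
  · exact C.inj h1
  · exfalso
    have h1 := C.inj h1
    have h2 := C.inj h2
    apply zmod_two_ne_zero C.three_le
    linear_combination h2 - h1

lemma edge_sub_one (i : ZMod C.L) : C.edge (i - 1) = s(C.z i, C.z (i - 1)) := by
  rw [edge, sub_add_cancel, Sym2.eq_swap]

lemma eq_of_edge_eq {i : ZMod C.L} {v w : V} (h : s(v, w) = C.edge i) :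
    (v = C.z i ∧ w = C.z (i + 1)) ∨ (v = C.z (i + 1) ∧ w = C.z i) :=
  Sym2.eq_iff.1 h

/-- The set of vertices of the cycle. -/
def verts : Set V := Set.range C.z

lemma z_mem (i : ZMod C.L) : C.z i ∈ C.verts := ⟨i, rfl⟩

lemma mk_ne_edge_of_left {v w : V} (hv : v ∉ C.verts) (i : ZMod C.L) : s(v, w) ≠ C.edge i := by
  intro h
  rcases C.eq_of_edge_eq h with ⟨rfl, -⟩ | ⟨rfl, -⟩ <;> exact hv (C.z_mem _)

lemma stub_ne_edge {i k : ZMod C.L} {w : V} (h1 : w ≠ C.z (i + 1)) (h2 : w ≠ C.z (i - 1)) :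
    s(C.z i, w) ≠ C.edge k := by
  intro h
  rcases C.eq_of_edge_eq h with ⟨h3, h4⟩ | ⟨h3, h4⟩
  · rw [C.inj h3] at h1; exact h1 h4
  · rw [C.inj h3] at h2; simp [h4] at h2

open Classical in
/-- The colouring that agrees with `φ` on the edges of the cycle and with `c` elsewhere. -/
noncomputable def recolor (c : Sym2 V → Option (Fin 3)) (φ : ZMod C.L → Option (Fin 3)) :
    Sym2 V → Option (Fin 3) :=
  fun e => if h : ∃ i, e = C.edge i then φ h.choose else c e

variable {c : Sym2 V → Option (Fin 3)} {φ : ZMod C.L → Option (Fin 3)}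

lemma recolor_edge (i : ZMod C.L) : C.recolor c φ (C.edge i) = φ i := by
  have h : ∃ k, C.edge i = C.edge k := ⟨i, rfl⟩
  rw [recolor, dif_pos h, ← C.edge_injective h.choose_spec]

lemma recolor_of_ne {e : Sym2 V} (h : ∀ i, e ≠ C.edge i) : C.recolor c φ e = c e := by
  rw [recolor, dif_neg (by simpa using h)]

end OddCycle

variable {V : Type*} [Fintype V] [DecidableEq V] {G : SimpleGraph V} [DecidableRel G.Adj]
  {c : Sym2 V → Option (Fin 3)}

/-- `C` is an alternating cycle of the partial colouring `c`: its edges have the colours `p`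
and `q`, apart from the `j`-th edge, which is uncoloured, and no other edge of `G` at a vertex of
`C` has one of these two colours. -/
structure Alternating (c : Sym2 V → Option (Fin 3)) (C : OddCycle G) (j : ZMod C.L)
    (p q : Fin 3) : Prop where
  ne : p ≠ q
  unc : c (C.edge j) = none
  col : ∀ i, i ≠ j → c (C.edge i) = some p ∨ c (C.edge i) = some q
  stub : ∀ i w, G.Adj (C.z i) w → w ≠ C.z (i + 1) → w ≠ C.z (i - 1) →
    c s(C.z i, w) ≠ some p ∧ c s(C.z i, w) ≠ some q

namespace Alternating

variable {C : OddCycle G} {j : ZMod C.L} {p q : Fin 3}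

lemma swap (h : Alternating c C j p q) : Alternating c C j q p :=
  ⟨h.ne.symm, h.unc, fun i hi => (h.col i hi).symm, fun i w a b d => (h.stub i w a b d).symm⟩

lemma eq_of_unc (h : Alternating c C j p q) {i : ZMod C.L} (hi : c (C.edge i) = none) : i = j := by
  by_contra hne
  rcases h.col i hne with h1 | h1 <;> simp [h1] at hi

/-- Edges of the two colours of an alternating cycle do not leave it. -/
lemma mem_of_color (h : Alternating c C j p q) {v w : V} (hv : v ∈ C.verts) (hvw : G.Adj v w)
    (hcol : c s(v, w) = some p ∨ c s(v, w) = some q) : w ∈ C.verts := by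
  obtain ⟨i, rfl⟩ := hv
  by_contra hw
  have h1 := h.stub i w hvw (fun h => hw (h ▸ C.z_mem _)) (fun h => hw (h ▸ C.z_mem _))
  tauto

/-- A recolouring that changes no edge at the vertices of an alternating cycle preserves it. -/
lemma congr (h : Alternating c C j p q) {c' : Sym2 V → Option (Fin 3)}
    (hc' : ∀ v w, v ∈ C.verts → G.Adj v w → c' s(v, w) = c s(v, w)) : Alternating c' C j p q := by
  refine ⟨h.ne, ?_, ?_, ?_⟩
  · rw [← h.unc]; exact hc' _ _ (C.z_mem _) (C.adj _)
  · intro i hi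
    have := hc' _ _ (C.z_mem i) (C.adj i)
    rw [OddCycle.edge, this]; exact h.col i hi
  · intro i w hw h1 h2
    rw [hc' _ _ (C.z_mem i) hw]; exact h.stub i w hw h1 h2

end Alternating

/-- The alternating pattern on a cycle of odd length with the `j`-th edge uncoloured; the edge
after it has the colour `p`, and the edge before it the colour `q`. -/
def altPattern {L : ℕ} (j : ZMod L) (p q : Fin 3) (i : ZMod L) : Option (Fin 3) :=
  if i = j then none else some (if (i - j).val % 2 = 1 then p else q)

section Pattern

variable {L : ℕ} {j i : ZMod L} {p q : Fin 3}

lemma altPattern_self : altPattern j p q j = none := by simp [altPattern]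

lemma altPattern_of_ne (h : i ≠ j) : altPattern j p q i = some p ∨ altPattern j p q i = some q := by
  unfold altPattern
  rw [if_neg h]
  split_ifs <;> simp

lemma altPattern_succ (hL : 3 ≤ L) : altPattern j p q (j + 1) = some p := by
  have : Fact (1 < L) := ⟨by omega⟩
  have h1 : (1 : ZMod L).val = 1 := ZMod.val_one L
  unfold altPattern
  rw [if_neg (by simp)]
  simp [h1]

lemma altPattern_pred (hL : 3 ≤ L) (hodd : Odd L) : altPattern j p q (j - 1) = some q := by
  have : NeZero L := ⟨by omega⟩
  have h1 : ((-1 : ZMod L)).val = L - 1 := by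
    have : Fact (1 < L) := ⟨by omega⟩
    rw [ZMod.neg_val, if_neg (zmod_one_ne_zero hL), ZMod.val_one]
  unfold altPattern
  rw [if_neg (by simpa using zmod_one_ne_zero hL)]
  have : (j - 1 - j) = -1 := by ring
  obtain ⟨m, rfl⟩ := hodd
  rw [this, h1, if_neg (by omega)]

lemma altPattern_ne_succ (hL : 3 ≤ L) (hpq : p ≠ q) {k : Fin 3} (h : altPattern j p q i = some k) :
    altPattern j p q (i + 1) ≠ some k := by
  by_cases h1 : i = j
  · simp [altPattern, h1] at h
  by_cases h2 : i + 1 = j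
  · simp [altPattern, h2]
  have h3 : (i + 1 - j).val = (i - j).val + 1 := by
    have := zmod_val_add_one hL (i - j) (by
      intro h; apply h2; linear_combination h)
    rw [← this]; congr 1; ring
  rw [altPattern, if_neg h1] at h
  rw [altPattern, if_neg h2, h3]
  intro h4
  rw [← h4, Option.some.injEq] at h
  rcases Nat.mod_two_eq_zero_or_one (i - j).val with h5 | h5
  · rw [if_neg (by omega), if_pos (by omega)] at h
    exact hpq h.symm
  · rw [if_pos (by omega), if_neg (by omega)] at h
    exact hpq h

end Pattern

/-- The edges of an odd cycle may be recoloured properly by two colours that do not occur on the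
other edges at the cycle. -/
lemma isProper_recolor (hc : IsProper G c) {C : OddCycle G} {p q : Fin 3}
    {φ : ZMod C.L → Option (Fin 3)}
    (hstub : ∀ i w, G.Adj (C.z i) w → w ≠ C.z (i + 1) → w ≠ C.z (i - 1) →
      c s(C.z i, w) ≠ some p ∧ c s(C.z i, w) ≠ some q)
    (hφ : ∀ i k, φ i = some k → k = p ∨ k = q)
    (hne : ∀ i k, φ i = some k → φ (i + 1) ≠ some k) : IsProper G (C.recolor c φ) := by
  have key : ∀ ⦃v w w' : V⦄ ⦃k : Fin 3⦄, G.Adj v w' → (∃ i, s(v, w) = C.edge i) →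
      (∀ i, s(v, w') ≠ C.edge i) → C.recolor c φ s(v, w) = some k →
      C.recolor c φ s(v, w') ≠ some k := by
    rintro v w w' k hw' ⟨i, hi⟩ h2 h
    rw [hi, C.recolor_edge] at h
    rw [C.recolor_of_ne h2]
    have hk := hφ i k h
    have : ∃ i, v = C.z i := by
      rcases C.eq_of_edge_eq hi with ⟨rfl, -⟩ | ⟨rfl, -⟩ <;> exact ⟨_, rfl⟩
    obtain ⟨l, rfl⟩ := this
    have := hstub l w' hw' (fun h => h2 l (by rw [h]; rfl))
      (fun h => h2 (l - 1) (by rw [h, C.edge_sub_one]))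
    rcases hk with rfl | rfl
    · exact this.1
    · exact this.2
  intro v w w' k hw hw' h h'
  by_cases h1 : ∃ i, s(v, w) = C.edge i
  · by_cases h2 : ∃ i, s(v, w') = C.edge i
    · obtain ⟨i, hi⟩ := h1
      obtain ⟨l, hl⟩ := h2
      rw [hi, C.recolor_edge] at h
      rw [hl, C.recolor_edge] at h'
      rcases C.eq_of_edge_eq hi with ⟨h3, h4⟩ | ⟨h3, h4⟩ <;>
        rcases C.eq_of_edge_eq hl with ⟨h5, h6⟩ | ⟨h5, h6⟩
      · rw [h4, h6, C.inj (h3.symm.trans h5)]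
      · rw [C.inj (h3.symm.trans h5)] at h
        exact absurd h (hne _ _ h')
      · rw [← C.inj (h3.symm.trans h5)] at h'
        exact absurd h' (hne _ _ h)
      · rw [h4, h6, add_right_cancel (C.inj (h3.symm.trans h5))]
    · push Not at h2
      exact absurd h' (key hw' h1 h2 h)
  · by_cases h2 : ∃ i, s(v, w') = C.edge i
    · push Not at h1
      exact absurd h (key hw h2 h1 h')
    · push Not at h1 h2
      rw [C.recolor_of_ne h1] at h
      rw [C.recolor_of_ne h2] at h'
      exact hc hw hw' h h'

/-- The uncoloured edge of an alternating cycle can be moved to any place of the cycle, with `p`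
as the colour of the edge after it and `q` as the colour of the edge before it; applied to
`Alternating.swap` this gives the other order of the colours. -/
lemma Alternating.rotate (hc : IsOptimal G c) {C : OddCycle G} {j : ZMod C.L} {p q : Fin 3}
    (h : Alternating c C j p q) (j' : ZMod C.L) :
    ∃ c', IsOptimal G c' ∧ Alternating c' C j' p q ∧ c' (C.edge (j' + 1)) = some p ∧
      c' (C.edge (j' - 1)) = some q ∧ (∀ e, (∀ i, e ≠ C.edge i) → c' e = c e) ∧
      uncolored G c' = insert (C.edge j') ((uncolored G c).erase (C.edge j)) := by
  set φ : ZMod C.L → Option (Fin 3) := altPattern j' p q with hφ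
  have hedge : ∀ i, C.recolor c φ (C.edge i) = φ i := fun i => C.recolor_edge i
  have hoff : ∀ e, (∀ i, e ≠ C.edge i) → C.recolor c φ e = c e := fun e he => C.recolor_of_ne he
  have hU : uncolored G (C.recolor c φ) = insert (C.edge j') ((uncolored G c).erase (C.edge j)) := by
    ext e
    rw [Finset.mem_insert, Finset.mem_erase, mem_uncolored, mem_uncolored]
    by_cases he : ∃ i, e = C.edge i
    · obtain ⟨i, rfl⟩ := he
      rw [hedge]
      constructor
      · rintro ⟨-, h2⟩
        left
        by_contra hne
        rcases altPattern_of_ne (p := p) (q := q) (fun h => hne (congrArg C.edge h)) with h3 | h3 <;>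
          simp [hφ, h3] at h2
      · rintro (h2 | ⟨h2, h3, h4⟩)
        · rw [C.edge_injective h2]
          exact ⟨C.edge_mem _, altPattern_self⟩
        · exact absurd (congrArg C.edge (h.eq_of_unc h4)) h2
    · push Not at he
      rw [hoff e he]
      constructor
      · exact fun h2 => Or.inr ⟨he j, h2⟩
      · rintro (h2 | h2)
        · exact absurd h2 (he _)
        · exact h2.2
  refine ⟨C.recolor c φ, hc.of_card_eq ?_ ?_, ⟨h.ne, ?_, ?_, ?_⟩, ?_, ?_, hoff, hU⟩
  · refine isProper_recolor hc.1 h.stub ?_ (fun i k => altPattern_ne_succ C.three_le h.ne)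
    intro i k hk
    by_cases hi : i = j'
    · rw [hφ, hi, altPattern_self] at hk; simp at hk
    · rcases altPattern_of_ne (p := p) (q := q) hi with h3 | h3
      · left; rw [← hφ, hk] at h3; exact Option.some.inj h3
      · right; rw [← hφ, hk] at h3; exact Option.some.inj h3
  · have hj : C.edge j ∈ uncolored G c := mem_uncolored.2 ⟨C.edge_mem j, h.unc⟩
    have hnot : C.edge j' ∉ (uncolored G c).erase (C.edge j) := by
      rw [Finset.mem_erase, mem_uncolored]
      rintro ⟨h1, -, h2⟩
      exact h1 (congrArg C.edge (h.eq_of_unc h2))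
    rw [hU, Finset.card_insert_of_notMem hnot, Finset.card_erase_add_one hj]
  · rw [hedge]; exact altPattern_self
  · intro i hi
    rw [hedge]; exact altPattern_of_ne hi
  · intro i w hw h1 h2
    rw [hoff _ (fun k => C.stub_ne_edge h1 h2)]
    exact h.stub i w hw h1 h2
  · rw [hedge]; exact altPattern_succ C.three_le
  · rw [hedge]; exact altPattern_pred C.three_le C.odd

/-- In a minimal colouring every uncoloured edge lies on an alternating cycle in a colour missing
at its one end and a colour missing at its other end. -/
lemma IsOptimal.exists_alternating (hc : IsOptimal G c) {x y : V} {p q : Fin 3} (hxy : G.Adj x y)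
    (hn : c s(x, y) = none) (hx : Missing G c x p) (hy : Missing G c y q) :
    ∃ C : OddCycle G, Alternating c C (-1) p q ∧ C.z 0 = x ∧ C.z (-1) = y := by
  obtain ⟨P, hP⟩ := (hc.reachable hxy hn hx hy).exists_isPath
  have hpq : p ≠ q := fun h => hc.not_missing hxy hn hx (h ▸ hy)
  have hPadj : ∀ i, i < P.length → G.Adj (P.getVert i) (P.getVert (i + 1)) ∧
      (c s(P.getVert i, P.getVert (i + 1)) = some p ∨
        c s(P.getVert i, P.getVert (i + 1)) = some q) := fun i hi => P.adj_getVert_succ hi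
  have hinj : ∀ i k, i ≤ P.length → k ≤ P.length → P.getVert i = P.getVert k → i = k :=
    fun i k hi hk h => hP.getVert_injOn hi hk h
  have hpos : 0 < P.length := by
    rcases Nat.eq_zero_or_pos P.length with h0 | h0
    · exact absurd (P.eq_of_length_eq_zero h0) hxy.ne
    · exact h0
  -- The Kempe chain starts with the colour `q`, alternates, and ends with the colour `p`.
  have hparity : ∀ i, i < P.length →
      c s(P.getVert i, P.getVert (i + 1)) = some (if i % 2 = 0 then q else p) := by
    intro i
    induction i with
    | zero =>
      intro hi
      rcases (hPadj 0 hi).2 with h | h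
      · rw [P.getVert_zero] at h
        have h1 := (hPadj 0 hi).1
        rw [P.getVert_zero] at h1
        exact absurd h (hx _ h1)
      · simpa using h
    | succ i ih =>
      intro hi
      have h1 := ih (by omega)
      have h2 := hPadj i (by omega)
      have h3 := hPadj (i + 1) hi
      have hne : c s(P.getVert (i + 1), P.getVert (i + 1 + 1)) ≠
          some (if i % 2 = 0 then q else p) := by
        intro h4
        rw [Sym2.eq_swap] at h1
        have := hinj _ _ (by omega) (by omega) (hc.1 h2.1.symm h3.1 h1 h4)
        omega
      rcases Nat.mod_two_eq_zero_or_one i with h5 | h5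
      · rw [if_pos h5] at hne
        rw [if_neg (by omega)]
        tauto
      · rw [if_neg (by omega)] at hne
        rw [if_pos (by omega)]
        tauto
  have heven : P.length % 2 = 0 := by
    by_contra hodd
    have h1 := hparity (P.length - 1) (by omega)
    have h2 := (hPadj (P.length - 1) (by omega)).1
    rw [if_pos (by omega)] at h1
    rw [Nat.sub_add_cancel hpos, P.getVert_length] at h1 h2
    rw [Sym2.eq_swap] at h1
    exact hy _ h2.symm h1
  -- The cycle runs from `x = z 0` along the chain to `y = z (-1)` and back over the edge `xy`.
  set n := P.length with hn'
  have hval : ∀ i : ZMod (n + 1), i.val ≤ n := fun i => Nat.lt_succ_iff.1 (ZMod.val_lt i)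
  have hlast : ((-1 : ZMod (n + 1))).val = n := by simp [ZMod.val_neg_one]
  have hsucc : ∀ i : ZMod (n + 1), i ≠ -1 → (i + 1).val = i.val + 1 := fun i hi =>
    zmod_val_add_one (by omega) i (fun h => hi (by linear_combination h))
  have hvlt : ∀ i : ZMod (n + 1), i ≠ -1 → i.val < n := by
    intro i hi
    refine lt_of_le_of_ne (hval i) (fun h => hi (ZMod.val_injective _ (by rw [h, hlast])))
  let C : OddCycle G :=
    { L := n + 1
      z := fun i => P.getVert i.val
      odd := by rw [Nat.odd_iff]; omega
      three_le := by omega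
      inj := fun i k h => ZMod.val_injective _ (hinj _ _ (hval i) (hval k) h)
      adj := by
        intro i
        by_cases hi : i = -1
        · rw [hi]
          simp only [hlast, neg_add_cancel, ZMod.val_zero, P.getVert_zero]
          rw [hn', P.getVert_length]
          exact hxy.symm
        · rw [hsucc i hi]
          exact (hPadj i.val (hvlt i hi)).1 }
  have hz0 : C.z 0 = x := by
    change P.getVert (0 : ZMod (n + 1)).val = x
    rw [ZMod.val_zero, P.getVert_zero]
  have hz1 : C.z (-1) = y := by
    change P.getVert (-1 : ZMod (n + 1)).val = y
    rw [hlast, hn', P.getVert_length]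
  have hedge : ∀ i : ZMod (n + 1), i ≠ -1 →
      C.edge i = s(P.getVert i.val, P.getVert (i.val + 1)) := by
    intro i hi
    change s(P.getVert i.val, P.getVert (i + 1).val) = _
    rw [hsucc i hi]
  have hcol : ∀ i : ZMod (n + 1), i ≠ -1 → c (C.edge i) = some p ∨ c (C.edge i) = some q := by
    intro i hi
    rw [hedge i hi]
    exact (hPadj i.val (hvlt i hi)).2
  have hedge' : C.edge (-1) = s(x, y) := by
    change s(C.z (-1), C.z (-1 + 1)) = _
    rw [neg_add_cancel, hz0, hz1, Sym2.eq_swap]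
  refine ⟨C, ⟨hpq, by rw [hedge', hn], hcol, ?_⟩, hz0, hz1⟩
  -- The two cycle edges at an inner vertex of the path use up both colours.
  have inner : ∀ i : ZMod (n + 1), ∀ k, i ≠ 0 → i ≠ -1 → k = p ∨ k = q →
      c (C.edge i) = some k ∨ c (C.edge (i - 1)) = some k := by
    intro i k h0 h1 hk
    have h2 := hcol i h1
    have h3 := hcol (i - 1) (fun h => h0 (by linear_combination h))
    by_contra hcon
    push Not at hcon
    have : ∃ l, c (C.edge i) = some l ∧ c (C.edge (i - 1)) = some l := by
      rcases hk with rfl | rfl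
      · exact ⟨q, by tauto, by tauto⟩
      · exact ⟨p, by tauto, by tauto⟩
    obtain ⟨l, h4, h5⟩ := this
    rw [C.edge_sub_one] at h5
    exact C.z_succ_ne_pred i (hc.1 (C.adj i) (C.adj_sub i) h4 h5)
  have main : ∀ i : ZMod (n + 1), ∀ w k, k = p ∨ k = q → G.Adj (C.z i) w → w ≠ C.z (i + 1) →
      w ≠ C.z (i - 1) → c s(C.z i, w) ≠ some k := by
    intro i w k hk hw h1 h2 h3
    by_cases hi0 : i = 0
    · subst hi0
      have h01 : (0 : ZMod (n + 1)) ≠ -1 := by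
        intro h
        exact zmod_one_ne_zero C.three_le (by linear_combination h)
      rw [hz0] at h3 hw
      rcases hk with rfl | rfl
      · exact hx w hw h3
      · have h4 := hparity 0 hpos
        have h5 := hedge 0 h01
        rw [ZMod.val_zero] at h5
        rw [← h5, OddCycle.edge, hz0] at h4
        exact h1 (hc.1 hw (hz0 ▸ C.adj 0) h3 h4)
    · by_cases hi1 : i = -1
      · subst hi1
        rw [hz1] at h3 hw
        rcases hk with rfl | rfl
        · have h6 : (-1 - 1 : ZMod (n + 1)) ≠ -1 := by
            intro h
            exact zmod_one_ne_zero C.three_le (by linear_combination -h)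
          have h4 : c (C.edge (-1 - 1)) = some k := by
            rcases hcol (-1 - 1) h6 with h7 | h7
            · exact h7
            · rw [C.edge_sub_one, hz1] at h7
              exact absurd h7 (hy _ (hz1 ▸ C.adj_sub (-1)))
          rw [C.edge_sub_one, hz1] at h4
          exact h2 (hc.1 hw (hz1 ▸ C.adj_sub (-1)) h3 h4)
        · exact hy w hw h3
      · rcases inner i k hi0 hi1 hk with h4 | h4
        · exact h1 (hc.1 hw (C.adj i) h3 h4)
        · rw [C.edge_sub_one] at h4
          exact h2 (hc.1 hw (C.adj_sub i) h3 h4)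
  exact fun i w hw h1 h2 => ⟨main i w p (Or.inl rfl) hw h1 h2, main i w q (Or.inr rfl) hw h1 h2⟩

end ThreeColoring

/-! ### Disjointness of alternating cycles -/

namespace ThreeColoring

variable {V : Type*} [Fintype V] [DecidableEq V] {G : SimpleGraph V} [DecidableRel G.Adj]
  {c : Sym2 V → Option (Fin 3)}

lemma exists_third {p q : Fin 3} (h : p ≠ q) : ∃ r, r ≠ p ∧ r ≠ q ∧ ∀ k, k = p ∨ k = q ∨ k = r := by
  revert p q; decide

/-- Consecutive edges of a cycle have different colours. -/
lemma IsProper.edge_ne (hc : IsProper G c) (C : OddCycle G) {i : ZMod C.L} {k : Fin 3}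
    (h : c (C.edge i) = some k) : c (C.edge (i - 1)) ≠ some k := by
  intro h'
  rw [C.edge_sub_one] at h'
  exact C.z_succ_ne_pred i (hc (C.adj i) (C.adj_sub i) h h')

namespace Alternating

variable {C : OddCycle G} {j : ZMod C.L} {p q : Fin 3}

/-- At a vertex away from the uncoloured edge both colours of the cycle are present. -/
lemma colors_at (h : Alternating c C j p q) (hc : IsProper G c) {i : ZMod C.L} (h1 : i ≠ j)
    (h2 : i ≠ j + 1) :
    (c (C.edge i) = some p ∧ c (C.edge (i - 1)) = some q) ∨
      (c (C.edge i) = some q ∧ c (C.edge (i - 1)) = some p) := by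
  have h3 := h.col i h1
  have h4 := h.col (i - 1) (fun h => h2 (by linear_combination h))
  rcases h3 with h3 | h3
  · have := hc.edge_ne C h3
    tauto
  · have := hc.edge_ne C h3
    tauto

lemma not_missing (h : Alternating c C j p q) (hc : IsProper G c) {i : ZMod C.L} (h1 : i ≠ j)
    (h2 : i ≠ j + 1) : ¬ Missing G c (C.z i) p ∧ ¬ Missing G c (C.z i) q := by
  have h3 := h.colors_at hc h1 h2
  rw [C.edge_sub_one] at h3
  have e1 := C.adj i
  have e2 := C.adj_sub i
  constructor
  · intro hm
    rcases h3 with h3 | h3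
    · exact hm _ e1 h3.1
    · exact hm _ e2 h3.2
  · intro hm
    rcases h3 with h3 | h3
    · exact hm _ e2 h3.2
    · exact hm _ e1 h3.1

/-- The first end of the uncoloured edge misses the colour not used by its other cycle edge. -/
lemma missing_left (h : Alternating c C j p q) (hc : c (C.edge (j - 1)) = some q) :
    Missing G c (C.z j) p := by
  intro w hw hcw
  by_cases h1 : w = C.z (j + 1)
  · rw [h1] at hcw
    have := h.unc
    rw [OddCycle.edge, hcw] at this
    simp at this
  · by_cases h2 : w = C.z (j - 1)
    · rw [h2, ← C.edge_sub_one, hc] at hcw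
      exact h.ne (Option.some.inj hcw).symm
    · exact (h.stub j w hw h1 h2).1 hcw

/-- The second end of the uncoloured edge misses the colour not used by its other cycle edge. -/
lemma missing_right (h : Alternating c C j p q) (hc : c (C.edge (j + 1)) = some p) :
    Missing G c (C.z (j + 1)) q := by
  intro w hw hcw
  by_cases h1 : w = C.z (j + 1 + 1)
  · rw [h1] at hcw
    rw [OddCycle.edge, hcw] at hc
    exact h.ne (Option.some.inj hc).symm
  · by_cases h2 : w = C.z (j + 1 - 1)
    · have := h.unc
      rw [h2, ← C.edge_sub_one, add_sub_cancel_right, this] at hcw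
      simp at hcw
    · exact (h.stub (j + 1) w hw h1 h2).2 hcw

/-- In a minimal colouring the two ends of the uncoloured edge of an alternating cycle miss
different colours of the cycle. -/
lemma missing_ends (h : Alternating c C j p q) (hc : IsOptimal G c) :
    (c (C.edge (j + 1)) = some p ∧ c (C.edge (j - 1)) = some q ∧
      Missing G c (C.z j) p ∧ Missing G c (C.z (j + 1)) q) ∨
    (c (C.edge (j + 1)) = some q ∧ c (C.edge (j - 1)) = some p ∧
      Missing G c (C.z j) q ∧ Missing G c (C.z (j + 1)) p) := by
  have h1 := h.col (j + 1) (C.add_one_ne j)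
  have h2 := h.col (j - 1) (fun h => C.add_one_ne j (by linear_combination -h))
  have hun := h.unc
  rcases h1 with h1 | h1 <;> rcases h2 with h2 | h2
  · exact absurd (h.missing_right h1) (hc.not_missing (C.adj j) hun (h.swap.missing_left h2))
  · exact Or.inl ⟨h1, h2, h.missing_left h2, h.missing_right h1⟩
  · exact Or.inr ⟨h1, h2, h.swap.missing_left h2, h.swap.missing_right h1⟩
  · exact absurd (h.swap.missing_right h1) (hc.not_missing (C.adj j) hun (h.missing_left h2))

end Alternating

/-- In a minimal colouring of a subcubic graph the uncoloured edges form a matching. Otherwise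
the ends of two of them at `v` miss one and the same colour `t`, and moving the uncoloured edge
along the alternating cycle of one of them frees `t` at `v`. -/
lemma IsOptimal.eq_of_uncolored (hc : IsOptimal G c) (hd : ∀ v, G.degree v ≤ 3) {v u w : V}
    (hvu : G.Adj v u) (hvw : G.Adj v w) (hu : c s(v, u) = none) (hw : c s(v, w) = none) :
    u = w := by
  by_contra huw
  obtain ⟨t, ht⟩ := exists_missing (hd u) hvu.symm (by rwa [Sym2.eq_swap])
  have hvt := hc.not_missing hvu.symm (by rwa [Sym2.eq_swap]) ht
  simp only [Missing, not_forall, not_not] at hvt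
  obtain ⟨v', hvv', hcv'⟩ := hvt
  have hnb : ∀ y, G.Adj v y → y = u ∨ y = w ∨ y = v' := fun y hy =>
    eq_or_eq_or_eq_of_degree_le (hd v) hvu hvw hvv' huw
      (fun h => by rw [← h, hu] at hcv'; simp at hcv')
      (fun h => by rw [← h, hw] at hcv'; simp at hcv') hy
  have htw : Missing G c w t := by
    obtain ⟨t', ht'⟩ := exists_missing (hd w) hvw.symm (by rwa [Sym2.eq_swap])
    have hvt' := hc.not_missing hvw.symm (by rwa [Sym2.eq_swap]) ht'
    simp only [Missing, not_forall, not_not] at hvt'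
    obtain ⟨v'', hvv'', hcv''⟩ := hvt'
    rcases hnb v'' hvv'' with rfl | rfl | rfl
    · simp [hu] at hcv''
    · simp [hw] at hcv''
    · rw [hcv'] at hcv''
      rwa [Option.some.inj hcv'']
  obtain ⟨q, hq⟩ : ∃ q, q ≠ t := exists_ne t
  have hvq : Missing G c v q := by
    intro y hy hcy
    rcases hnb y hy with rfl | rfl | rfl
    · simp [hu] at hcy
    · simp [hw] at hcy
    · rw [hcv'] at hcy
      exact hq (Option.some.inj hcy).symm
  obtain ⟨C, hC, h0, h1⟩ := hc.exists_alternating hvu hu hvq ht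
  have hwC : w ∉ C.verts := by
    rintro ⟨i, rfl⟩
    have hi1 : i ≠ -1 := fun h => huw (by rw [h, h1])
    have hi0 : i ≠ -1 + 1 := fun h => hvw.ne (by rw [h, neg_add_cancel, h0])
    exact (hC.not_missing hc.1 hi1 hi0).2 htw
  obtain ⟨c', hc', hC', h2, h3, hoff, -⟩ := hC.swap.rotate hc 0
  have hm := hC'.missing_left h3
  rw [h0] at hm
  refine hc'.not_missing (k := t) hvw ?_ hm ?_
  · rw [hoff _ (fun i => by rw [Sym2.eq_swap]; exact C.mk_ne_edge_of_left hwC i), hw]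
  · intro y hy
    rw [hoff _ (C.mk_ne_edge_of_left hwC)]
    exact htw y hy

namespace Alternating

variable {C : OddCycle G} {j : ZMod C.L} {p q : Fin 3}

lemma stub_ne_none (h : Alternating c C j p q) (hc : IsOptimal G c) (hd : ∀ v, G.degree v ≤ 3)
    {i : ZMod C.L} {w : V} (hw : G.Adj (C.z i) w) (h1 : w ≠ C.z (i + 1)) (h2 : w ≠ C.z (i - 1)) :
    c s(C.z i, w) ≠ none := by
  intro hn
  obtain ⟨c', hc', hC', -, -, hoff, -⟩ := h.rotate hc i
  have hu := hC'.unc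
  refine h1 (hc'.eq_of_uncolored hd (C.adj i) hw hu ?_).symm
  rw [hoff _ (fun k => C.stub_ne_edge h1 h2), hn]

/-- All edges that leave an alternating cycle have the third colour. -/
lemma stub_color (h : Alternating c C j p q) (hc : IsOptimal G c) (hd : ∀ v, G.degree v ≤ 3)
    {r : Fin 3} (hr : ∀ k, k = p ∨ k = q ∨ k = r)
    {i : ZMod C.L} {w : V} (hw : G.Adj (C.z i) w) (h1 : w ≠ C.z (i + 1)) (h2 : w ≠ C.z (i - 1)) :
    c s(C.z i, w) = some r := by
  obtain ⟨k, hk⟩ := Option.ne_none_iff_exists'.1 (h.stub_ne_none hc hd hw h1 h2)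
  have h3 := h.stub i w hw h1 h2
  rw [hk] at h3 ⊢
  rcases hr k with rfl | rfl | rfl
  · exact absurd rfl h3.1
  · exact absurd rfl h3.2
  · rfl

/-- The only uncoloured edge at the vertices of an alternating cycle is the one on the cycle. -/
lemma edge_eq_of_uncolored (h : Alternating c C j p q) (hc : IsOptimal G c)
    (hd : ∀ v, G.degree v ≤ 3) {v w : V} (hv : v ∈ C.verts) (hvw : G.Adj v w)
    (hn : c s(v, w) = none) : s(v, w) = C.edge j := by
  obtain ⟨i, rfl⟩ := hv
  by_cases h1 : w = C.z (i + 1)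
  · subst h1
    rw [← h.eq_of_unc (i := i) hn]; rfl
  · by_cases h2 : w = C.z (i - 1)
    · subst h2
      rw [← C.edge_sub_one] at hn ⊢
      rw [← h.eq_of_unc hn]
    · exact absurd hn (h.stub_ne_none hc hd hvw h1 h2)

/-- A colour of an alternating cycle that is present at a vertex `w` of the cycle can be made
missing there by moving the uncoloured edge of the cycle to the edge of that colour. -/
lemma exists_free (h : Alternating c C j p q) (hc : IsOptimal G c)
    {w w' : V} (hw : w ∈ C.verts) (hww' : G.Adj w w')
    {t : Fin 3} (ht : t = p ∨ t = q) (hcol : c s(w, w') = some t) :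
    ∃ c', IsOptimal G c' ∧ Missing G c' w t ∧ (∀ e, (∀ i, e ≠ C.edge i) → c' e = c e) := by
  obtain ⟨i, rfl⟩ := hw
  have hcyc : w' = C.z (i + 1) ∨ w' = C.z (i - 1) := by
    by_contra! hcon
    have := h.stub i w' hww' hcon.1 hcon.2
    rcases ht with rfl | rfl
    · exact this.1 hcol
    · exact this.2 hcol
  have h' : ∃ t', Alternating c C j t t' := by
    rcases ht with rfl | rfl
    · exact ⟨q, h⟩
    · exact ⟨p, h.swap⟩
  obtain ⟨t', h'⟩ := h'
  rcases hcyc with rfl | rfl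
  · obtain ⟨c', hc', hC', -, h2, hoff, -⟩ := h'.rotate hc i
    exact ⟨c', hc', hC'.missing_left h2, hoff⟩
  · obtain ⟨c', hc', hC', h2, -, hoff, -⟩ := h'.swap.rotate hc (i - 1)
    have := hC'.missing_right h2
    rw [sub_add_cancel] at this
    exact ⟨c', hc', this, hoff⟩

/-- A path in two colours has at most one continuation: given an edge `xy` in one of the colours
`p` and `q`, at most one further edge at `x` has one of these colours. -/
lemma next_eq (hc : IsProper G c) {x y a b : V} {p q k : Fin 3}
    (hxa : G.Adj x a) (hxb : G.Adj x b) (hxy : G.Adj x y)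
    (ha : c s(x, a) = some p ∨ c s(x, a) = some q)
    (hb : c s(x, b) = some p ∨ c s(x, b) = some q)
    (hk : k = p ∨ k = q) (hy : c s(x, y) = some k) (hya : y ≠ a) (hyb : y ≠ b) : a = b := by
  have h1 : c s(x, a) ≠ some k := fun h => hya (hc hxy hxa hy h)
  have h2 : c s(x, b) ≠ some k := fun h => hyb (hc hxy hxb hy h)
  rcases hk with rfl | rfl
  · exact hc hxa hxb (by tauto) (by tauto : c s(x, b) = some q)
  · exact hc hxa hxb (by tauto) (by tauto : c s(x, b) = some p)

/-- Alternating cycles of different uncoloured edges of a minimal colouring have no common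
vertex. Otherwise follow the second cycle `D` from its uncoloured edge to the first vertex `w` on
`C` and make the next edge of `D`, which also lies on `C`, the uncoloured edge of `C`: then the
alternating cycle of the uncoloured edge of `D` gets stuck at `w`. -/
lemma disjoint (hC : Alternating c C j p q) {D : OddCycle G} {l : ZMod D.L} {p' q' : Fin 3}
    (hD : Alternating c D l p' q') (hc : IsOptimal G c) (hd : ∀ v, G.degree v ≤ 3)
    (hne : C.edge j ≠ D.edge l) {v : V} (hvC : v ∈ C.verts) : v ∉ D.verts := by
  rintro ⟨k, rfl⟩
  -- Normalise the colours at the ends of the uncoloured edge of `D`.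
  wlog hends : Missing G c (D.z l) q' ∧ Missing G c (D.z (l + 1)) p' generalizing p' q' with H
  · rcases hD.missing_ends hc with h | h
    · exact H hD.swap h.2.2
    · exact hends h.2.2
  obtain ⟨hmq, hmp⟩ := hends
  have hlC : D.z l ∉ C.verts := fun h =>
    hne (hC.edge_eq_of_uncolored hc hd h (D.adj l) hD.unc).symm
  have hlC' : D.z (l + 1) ∉ C.verts := fun h => by
    apply hne
    have := hC.edge_eq_of_uncolored hc hd h (D.adj l).symm (by
      rw [Sym2.eq_swap]; exact hD.unc)
    rw [← this, Sym2.eq_swap]; rfl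
  have hex : ∃ n : ℕ, D.z (l + 1 + n) ∈ C.verts := by
    refine ⟨(k - l - 1).val, ?_⟩
    rw [ZMod.natCast_val, ZMod.cast_id]
    have : l + 1 + (k - l - 1) = k := by ring
    rwa [this]
  classical
  set n := Nat.find hex with hn
  have hwC : D.z (l + 1 + n) ∈ C.verts := Nat.find_spec hex
  have hbefore : ∀ m : ℕ, m < n → D.z (l + 1 + m) ∉ C.verts := fun m hm => Nat.find_min hex hm
  have hn0 : n ≠ 0 := fun h => hlC' (by simpa [h] using hwC)
  have hml : ∀ m : ℕ, m ≤ n → l + 1 + (m : ZMod D.L) ≠ l := by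
    intro m hm h
    rcases hm.lt_or_eq with hm | rfl
    · have hmL : ((m + 1 : ℕ) : ZMod D.L) = 0 := by
        push_cast; linear_combination h
      have hle : D.L ≤ m + 1 := by
        rw [ZMod.natCast_eq_zero_iff] at hmL
        exact Nat.le_of_dvd (by omega) hmL
      have hkn : n ≤ (k - l - 1).val := by
        apply Nat.find_min' hex
        rw [ZMod.natCast_val, ZMod.cast_id]
        have : l + 1 + (k - l - 1) = k := by ring
        rwa [this]
      have := ZMod.val_lt (k - l - 1)
      omega
    · rw [h] at hwC; exact hlC hwC
  obtain ⟨n', hn'⟩ := Nat.exists_eq_succ_of_ne_zero hn0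
  have hcast : l + 1 + (n : ZMod D.L) - 1 = l + 1 + (n' : ZMod D.L) := by
    rw [hn']; push_cast; ring
  -- The edge by which `D` enters `C` has the third colour `r` of `C`.
  obtain ⟨r, hrp, hrq, hr⟩ := exists_third hC.ne
  set w := D.z (l + 1 + n) with hw
  have hprev : D.z (l + 1 + n - 1) ∉ C.verts := by
    rw [hcast]; exact hbefore n' (by omega)
  have hcr : c (D.edge (l + 1 + n - 1)) = some r := by
    rw [D.edge_sub_one]
    obtain ⟨i, hi⟩ := hwC
    rw [← hw, ← hi]
    exact hC.stub_color hc hd hr (by rw [hi]; exact D.adj_sub _)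
      (fun h => hprev (by rw [h]; exact C.z_mem _)) (fun h => hprev (by rw [h]; exact C.z_mem _))
  have hrD : r = p' ∨ r = q' := by
    have := hD.col (l + 1 + n - 1) (by rw [hcast]; exact hml n' (by omega))
    rw [hcr] at this
    simpa using this
  -- Its next edge has another colour `t`, hence a colour of `C`, and `t` can be freed at `w`.
  obtain ⟨t, htr, ht⟩ : ∃ t, t ≠ r ∧ c (D.edge (l + 1 + n)) = some t := by
    rcases hD.col (l + 1 + n) (hml n le_rfl) with h | h
    · exact ⟨p', fun h' => hc.1.edge_ne D h (h' ▸ hcr), h⟩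
    · exact ⟨q', fun h' => hc.1.edge_ne D h (h' ▸ hcr), h⟩
  have htD : t = p' ∨ t = q' := by
    have := hD.col (l + 1 + n) (hml n le_rfl)
    rw [ht] at this
    simpa using this
  have htC : t = p ∨ t = q := by
    rcases hr t with h | h | h
    · exact Or.inl h
    · exact Or.inr h
    · exact absurd h htr
  obtain ⟨c', hc', hmiss, hoff⟩ := hC.exists_free hc hwC (D.adj _) htC ht
  have hsame : ∀ x y, x ∉ C.verts → c' s(x, y) = c s(x, y) := fun x y hx =>
    hoff _ (C.mk_ne_edge_of_left hx)
  -- In the new colouring, the alternating cycle `D'` has to follow `D` up to `w`.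
  obtain ⟨D', hD', h0, h1⟩ := hc'.exists_alternating (x := D.z (l + 1)) (y := D.z l)
    (p := p') (q := q') (D.adj l).symm (by rw [hsame _ _ hlC', Sym2.eq_swap]; exact hD.unc)
    (fun y hy => by rw [hsame _ _ hlC']; exact hmp y hy)
    (fun y hy => by rw [hsame _ _ hlC]; exact hmq y hy)
  have hD'ne : ∀ m : ℕ, m ≤ n → D'.z m = D.z (l + 1 + m) → (m : ZMod D'.L) ≠ -1 := by
    intro m hm h h2
    rw [h2, h1] at h
    exact hml m hm (D.inj h).symm
  have follow : ∀ m : ℕ, m ≤ n → D'.z m = D.z (l + 1 + m) ∧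
      ((m : ZMod D'.L) ≠ 0 → D'.z (m - 1) = D.z (l + 1 + m - 1)) := by
    intro m
    induction m with
    | zero => intro _; simp [h0]
    | succ m ih =>
      intro hm
      obtain ⟨ih1, ih2⟩ := ih (by omega)
      have e1 : ((m + 1 : ℕ) : ZMod D'.L) = m + 1 := by push_cast; rfl
      have e2 : l + 1 + ((m + 1 : ℕ) : ZMod D.L) = l + 1 + m + 1 := by push_cast; ring
      rw [e1, e2, add_sub_cancel_right, add_sub_cancel_right]
      refine ⟨?_, fun _ => ih1⟩
      have hx : D.z (l + 1 + m) ∉ C.verts := hbefore m (by omega)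
      have ha := hD'.col m (hD'ne m (by omega) ih1)
      have hb := hD.col (l + 1 + m) (hml m (by omega))
      rw [OddCycle.edge] at ha hb
      rw [ih1] at ha
      rw [← hsame _ _ hx] at hb
      have ga : G.Adj (D.z (l + 1 + m)) (D'.z (m + 1)) := ih1 ▸ D'.adj m
      by_cases hm0 : (m : ZMod D'.L) = 0
      · have hx' : D.z (l + 1 + m) = D.z (l + 1) := by rw [← ih1, hm0, h0]
        have hm' : Missing G c' (D.z (l + 1 + m)) p' := by
          intro y hy
          rw [hsame _ _ hx, hx']
          exact hmp y (hx' ▸ hy)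
        refine hc'.1 ga (D.adj _) (ha.resolve_left (hm' _ ga)) (hb.resolve_left (hm' _ (D.adj _)))
      · have ih2 := ih2 hm0
        have hy := hD'.col (m - 1) (fun h => hm0 (by linear_combination h))
        rw [D'.edge_sub_one, ih1, ih2] at hy
        have hk : ∃ k, (k = p' ∨ k = q') ∧
            c' s(D.z (l + 1 + m), D.z (l + 1 + m - 1)) = some k := by
          rcases hy with hy | hy
          · exact ⟨p', Or.inl rfl, hy⟩
          · exact ⟨q', Or.inr rfl, hy⟩
        obtain ⟨k', hk', hy⟩ := hk
        refine next_eq hc'.1 ga (D.adj _) (D.adj_sub _) ha hb hk' hy ?_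
          (D.z_succ_ne_pred _).symm
        rw [← ih2]; exact (D'.z_succ_ne_pred _).symm
  -- It enters `w` by the colour `r` and cannot leave by `t`, which is now missing there.
  obtain ⟨f1, f2⟩ := follow n le_rfl
  have hn0' : (n : ZMod D'.L) ≠ 0 := by
    intro h
    rw [h, h0] at f1
    exact hlC' (f1 ▸ hwC)
  have f2 := f2 hn0'
  have g1 := hD'.col n (hD'ne n le_rfl f1)
  have hcr' : c' (D'.edge (n - 1)) = some r := by
    rw [D'.edge_sub_one, f1, f2, Sym2.eq_swap, hsame _ _ hprev, Sym2.eq_swap, ← D.edge_sub_one, hcr]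
  have g2 : c' (D'.edge n) ≠ some r := fun h => hc'.1.edge_ne D' h hcr'
  have g3 : c' (D'.edge n) ≠ some t := by
    have := D'.adj n
    rw [f1] at this
    rw [OddCycle.edge, f1]
    exact hmiss _ this
  have g4 : p' ≠ q' := hD.ne
  rcases htD with rfl | rfl <;> rcases hrD with rfl | rfl <;> tauto

end Alternating

end ThreeColoring

/-! ### The switch of two alternating cycles joined by an edge -/

namespace ThreeColoring

variable {V : Type*} [Fintype V] [DecidableEq V] {G : SimpleGraph V} [DecidableRel G.Adj]
  {c : Sym2 V → Option (Fin 3)}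

lemma OddCycle.two_le_degree (C : OddCycle G) (i : ZMod C.L) : 2 ≤ G.degree (C.z i) := by
  have h : ({C.z (i + 1), C.z (i - 1)} : Finset V) ⊆ G.neighborFinset (C.z i) := by
    intro u hu
    simp only [Finset.mem_insert, Finset.mem_singleton] at hu
    rcases hu with rfl | rfl
    · simpa using C.adj i
    · simpa using C.adj_sub i
  have := Finset.card_le_card h
  rwa [Finset.card_pair (C.z_succ_ne_pred i), G.card_neighborFinset_eq_degree] at this

lemma OddCycle.degree_eq_three (C : OddCycle G) (hd : ∀ v, G.degree v ≤ 3) {i : ZMod C.L} {w : V}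
    (hw : G.Adj (C.z i) w) (h1 : w ≠ C.z (i + 1)) (h2 : w ≠ C.z (i - 1)) :
    G.degree (C.z i) = 3 := by
  have h : ({w, C.z (i + 1), C.z (i - 1)} : Finset V) ⊆ G.neighborFinset (C.z i) := by
    intro u hu
    simp only [Finset.mem_insert, Finset.mem_singleton] at hu
    rcases hu with rfl | rfl | rfl
    · simpa using hw
    · simpa using C.adj i
    · simpa using C.adj_sub i
  have := Finset.card_le_card h
  rw [Finset.card_insert_of_notMem (by simp [h1, h2]), Finset.card_pair (C.z_succ_ne_pred i),
    G.card_neighborFinset_eq_degree] at this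
  exact le_antisymm (hd _) this

lemma OddCycle.exists_stub (C : OddCycle G) {i : ZMod C.L} (h : G.degree (C.z i) = 3) :
    ∃ w, G.Adj (C.z i) w ∧ w ≠ C.z (i + 1) ∧ w ≠ C.z (i - 1) := by
  by_contra! hcon
  have hsub : G.neighborFinset (C.z i) ⊆ {C.z (i + 1), C.z (i - 1)} := by
    intro u hu
    rw [SimpleGraph.mem_neighborFinset] at hu
    simp only [Finset.mem_insert, Finset.mem_singleton]
    by_contra! h
    exact h.2 (hcon u hu h.1)
  have h4 := (Finset.card_le_card hsub).trans Finset.card_le_two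
  rw [G.card_neighborFinset_eq_degree] at h4
  omega

/-- A neighbourhood of the `i`-th vertex of `C` lies on the cycle `E`: the vertex itself, its two
neighbours on `C`, and the further neighbours of these, which have degree three. -/
structure Absorbs (C : OddCycle G) (i : ZMod C.L) (E : OddCycle G) : Prop where
  self : C.z i ∈ E.verts
  succ : C.z (i + 1) ∈ E.verts
  pred : C.z (i - 1) ∈ E.verts
  succ_adj : ∀ w, G.Adj (C.z (i + 1)) w → w ∉ C.verts → w ∈ E.verts
  pred_adj : ∀ w, G.Adj (C.z (i - 1)) w → w ∉ C.verts → w ∈ E.verts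
  succ_degree : G.degree (C.z (i + 1)) = 3
  pred_degree : G.degree (C.z (i - 1)) = 3

/-- The situation at each of the two cycles after the edge `ab` has been recoloured: the edge
from `C.z i` to its predecessor is uncoloured, and the colour `r` of the edges that leave `C` is
missing at `C.z i`. The alternating cycle in the colours `r` and `q` then runs through the neighbours of
`C.z i` on `C` and leaves `C` at both of them. -/
lemma exists_absorbs (hc : IsOptimal G c) (hd : ∀ v, G.degree v ≤ 3) {C : OddCycle G}
    {i : ZMod C.L} {q r : Fin 3} (hn : c (C.edge (i - 1)) = none)
    (hr : Missing G c (C.z i) r) (hq : Missing G c (C.z (i - 1)) q)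
    (hcol : c (C.edge i) = some q) (hcol' : c (C.edge (i + 1)) ≠ some r)
    (hcol'' : c (C.edge (i - 1 - 1)) ≠ some r)
    (hs : ∀ w, G.Adj (C.z (i + 1)) w → w ∉ C.verts → c s(C.z (i + 1), w) = some r)
    (hp : ∀ w, G.Adj (C.z (i - 1)) w → w ∉ C.verts → c s(C.z (i - 1), w) = some r) :
    ∃ E : OddCycle G, Alternating c E (-1) r q ∧ E.edge (-1) = C.edge (i - 1) ∧
      Absorbs C i E := by
  have hn' : c s(C.z i, C.z (i - 1)) = none := by rw [← C.edge_sub_one, hn]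
  obtain ⟨E, hE, h0, h1⟩ := hc.exists_alternating (C.adj_sub i) hn' hr hq
  have hsucc : C.z (i + 1) ∈ E.verts :=
    hE.mem_of_color ⟨0, h0⟩ (C.adj i) (Or.inr hcol)
  have hpred : C.z (i - 1) ∈ E.verts := ⟨-1, h1⟩
  have hE1 : E.z 1 = C.z (i + 1) := by
    have h01 : (0 : ZMod E.L) ≠ -1 := fun h =>
      zmod_one_ne_zero E.three_le (by linear_combination h)
    have g := E.adj 0
    have h := hE.col 0 h01
    rw [OddCycle.edge, h0, zero_add] at h
    rw [h0, zero_add] at g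
    exact hc.1 g (C.adj i) (h.resolve_left (hr _ g)) hcol
  refine ⟨E, hE, ?_, ⟨⟨0, h0⟩, hsucc, hpred, ?_, ?_, ?_, ?_⟩⟩
  · rw [C.edge_sub_one, OddCycle.edge, h1, neg_add_cancel, h0, Sym2.eq_swap]
  · exact fun w hw hwC => hE.mem_of_color hsucc hw (Or.inl (hs w hw hwC))
  · exact fun w hw hwC => hE.mem_of_color hpred hw (Or.inl (hp w hw hwC))
  · have := (hE.not_missing hc.1 (i := 1)
      (fun h => zmod_two_ne_zero E.three_le (by linear_combination h))
      (by rw [neg_add_cancel]; exact zmod_one_ne_zero E.three_le)).1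
    simp only [Missing, not_forall, not_not] at this
    obtain ⟨w, hw, hcw⟩ := this
    rw [hE1] at hw hcw
    refine C.degree_eq_three hd hw ?_ ?_
    · rintro rfl; exact hcol' hcw
    · rintro rfl
      rw [← C.edge_sub_one, add_sub_cancel_right, hcol] at hcw
      exact hE.ne (Option.some.inj hcw).symm
  · have := hc.not_missing (C.adj_sub i) hn' hr
    simp only [Missing, not_forall, not_not] at this
    obtain ⟨w, hw, hcw⟩ := this
    refine C.degree_eq_three hd hw ?_ ?_
    · rintro rfl
      rw [← OddCycle.edge, hn] at hcw; simp at hcw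
    · rintro rfl
      rw [← C.edge_sub_one] at hcw
      exact hcol'' hcw

/-- The switch. If two alternating cycles of a minimal colouring are joined by an edge `ab`, then
they have the same two colours. After moving both uncoloured edges next to `a` and `b`, the edge
`ab` can be given one of these colours; in the new colouring, the alternating cycles of the two
uncoloured edges in the other pairs of colours absorb the vicinity of `a` and of `b`. -/
lemma Alternating.switch {C D : OddCycle G} {j : ZMod C.L} {l : ZMod D.L} {p q p' q' : Fin 3}
    (hC : Alternating c C j p q) (hD : Alternating c D l p' q') (hc : IsOptimal G c)
    (hd : ∀ v, G.degree v ≤ 3) (hne : C.edge j ≠ D.edge l) {i : ZMod C.L} {k : ZMod D.L}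
    (hadj : G.Adj (C.z i) (D.z k)) :
    ∃ (c₂ : Sym2 V → Option (Fin 3)) (E F : OddCycle G) (q r : Fin 3), IsOptimal G c₂ ∧
      Alternating c₂ E (-1) r q ∧ Alternating c₂ F (-1) r q ∧
      E.edge (-1) = C.edge (i - 1) ∧ F.edge (-1) = D.edge (k - 1) ∧
      Absorbs C i E ∧ Absorbs D k F ∧
      uncolored G c₂ = insert (D.edge (k - 1)) ((insert (C.edge (i - 1))
        ((uncolored G c).erase (C.edge j))).erase (D.edge l)) ∧
      ∀ (H : OddCycle G) (m : ZMod H.L) (a b : Fin 3), Alternating c H m a b →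
        H.edge m ≠ C.edge j → H.edge m ≠ D.edge l → Alternating c₂ H m a b := by
  have hCD : ∀ v, v ∈ C.verts → v ∉ D.verts := fun v hv => hC.disjoint hD hc hd hne hv
  have hDC : ∀ v, v ∈ D.verts → v ∉ C.verts := fun v hv h => hCD v h hv
  obtain ⟨r, hrp, hrq, hr⟩ := exists_third hC.ne
  have habr : c s(C.z i, D.z k) = some r :=
    hC.stub_color hc hd hr hadj (fun h => hDC _ (D.z_mem k) (h ▸ C.z_mem _))
      (fun h => hDC _ (D.z_mem k) (h ▸ C.z_mem _))
  have hD : Alternating c D l p q := by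
    have h1 := hD.stub k (C.z i) hadj.symm (fun h => hCD _ (C.z_mem i) (h ▸ D.z_mem _))
      (fun h => hCD _ (C.z_mem i) (h ▸ D.z_mem _))
    rw [Sym2.eq_swap, habr] at h1
    have h2 := hD.ne
    rcases hr p' with rfl | rfl | rfl
    · rcases hr q' with rfl | rfl | rfl
      · exact absurd rfl h2
      · exact hD
      · exact absurd rfl h1.2
    · rcases hr q' with rfl | rfl | rfl
      · exact hD.swap
      · exact absurd rfl h2
      · exact absurd rfl h1.2
    · exact absurd rfl h1.1
  -- Move the uncoloured edges next to `a = C.z i` and `b = D.z k`.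
  obtain ⟨c₀, hc₀, hC₀, hC₀s, hC₀p, hoff₀, hU₀⟩ := hC.swap.rotate hc (i - 1)
  have hD₀ : Alternating c₀ D l p q :=
    hD.congr fun v w hv _ => hoff₀ _ (C.mk_ne_edge_of_left (hDC v hv))
  obtain ⟨c₁, hc₁, hD₁, hD₁s, hD₁p, hoff₁, hU₁⟩ := hD₀.swap.rotate hc₀ (k - 1)
  have hsame₁ : ∀ v w, v ∉ D.verts → c₁ s(v, w) = c₀ s(v, w) := fun v w hv =>
    hoff₁ _ (D.mk_ne_edge_of_left hv)
  have hC₁ : Alternating c₁ C (i - 1) q p :=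
    hC₀.congr fun v w hv _ => hsame₁ v w (hCD v hv)
  have hC₁s : c₁ (C.edge (i - 1 + 1)) = some q := by
    rw [OddCycle.edge, hsame₁ _ _ (hCD _ (C.z_mem _))]; exact hC₀s
  have hC₁p : c₁ (C.edge (i - 1 - 1)) = some p := by
    rw [OddCycle.edge, hsame₁ _ _ (hCD _ (C.z_mem _))]; exact hC₀p
  have hap := hC₁.missing_right hC₁s
  have haq := hC₁.missing_left hC₁p
  have hbp := hD₁.missing_right hD₁s
  have hbq := hD₁.missing_left hD₁p
  rw [sub_add_cancel] at hap hbp hC₁s hD₁s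
  have habr₁ : c₁ s(C.z i, D.z k) = some r := by
    rw [hsame₁ _ _ (hCD _ (C.z_mem _)), Sym2.eq_swap,
      hoff₀ _ (C.mk_ne_edge_of_left (hDC _ (D.z_mem _))), Sym2.eq_swap, habr]
  have hrqp : ∀ k, k = q ∨ k = p ∨ k = r := fun k => by have := hr k; tauto
  have hCs : ∀ m w, G.Adj (C.z m) w → w ∉ C.verts → c₁ s(C.z m, w) = some r := fun m w hw hwC =>
    hC₁.stub_color hc₁ hd hrqp hw (fun h => hwC (h ▸ C.z_mem _)) (fun h => hwC (h ▸ C.z_mem _))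
  have hDs : ∀ m w, G.Adj (D.z m) w → w ∉ D.verts → c₁ s(D.z m, w) = some r := fun m w hw hwD =>
    hD₁.stub_color hc₁ hd hrqp hw (fun h => hwD (h ▸ D.z_mem _)) (fun h => hwD (h ▸ D.z_mem _))
  -- Now recolour the edge `ab`.
  set c₂ := Function.update c₁ s(C.z i, D.z k) (some p) with hc₂
  have hsame₂ : ∀ e, e ≠ s(C.z i, D.z k) → c₂ e = c₁ e := fun e he => Function.update_of_ne he _ _
  have hsame₂' : ∀ v w, v ≠ C.z i → v ≠ D.z k → c₂ s(v, w) = c₁ s(v, w) := by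
    intro v w h1 h2
    apply hsame₂
    intro h
    rcases Sym2.eq_iff.1 h with ⟨rfl, -⟩ | ⟨rfl, -⟩
    · exact h1 rfl
    · exact h2 rfl
  have hab₂ : c₂ s(C.z i, D.z k) = some p := Function.update_self _ _ _
  have hU₂ : uncolored G c₂ = uncolored G c₁ := by
    ext e
    rw [mem_uncolored, mem_uncolored]
    rcases eq_or_ne e s(C.z i, D.z k) with rfl | he
    · rw [hab₂, habr₁]; simp
    · rw [hsame₂ e he]
  have hO₂ : IsOptimal G c₂ := hc₁.of_card_eq (hc₁.1.update hap hbp) (by rw [hU₂])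
  have hCneD : ∀ m n, C.z m ≠ D.z n := fun m n h => hCD _ (C.z_mem m) (h ▸ D.z_mem n)
  have har₂ : Missing G c₂ (C.z i) r := by
    intro w hw h
    by_cases hwb : w = D.z k
    · rw [hwb, hab₂] at h; exact hrp (Option.some.inj h).symm
    · rw [hsame₂ _ (fun h' => hwb (Sym2.congr_right.1 h'))] at h
      exact hwb (hc₁.1 hw hadj h habr₁)
  have hbr₂ : Missing G c₂ (D.z k) r := by
    intro w hw h
    by_cases hwb : w = C.z i
    · rw [hwb, Sym2.eq_swap, hab₂] at h; exact hrp (Option.some.inj h).symm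
    · rw [hsame₂ _ (fun h' => hwb (Sym2.congr_right.1 (h'.trans Sym2.eq_swap)))] at h
      exact hwb (hc₁.1 hw hadj.symm h (by rw [Sym2.eq_swap, habr₁]))
  have hCedge : ∀ m, c₂ (C.edge m) = c₁ (C.edge m) := by
    intro m
    apply hsame₂
    intro h
    rcases Sym2.eq_iff.1 h with ⟨-, h2⟩ | ⟨h1, -⟩
    · exact hCneD _ _ h2
    · exact hCneD _ _ h1
  have hDedge : ∀ m, c₂ (D.edge m) = c₁ (D.edge m) := by
    intro m
    apply hsame₂
    intro h
    rcases Sym2.eq_iff.1 h with ⟨h1, -⟩ | ⟨-, h2⟩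
    · exact hCneD _ _ h1.symm
    · exact hCneD _ _ h2.symm
  have hCr : ∀ m, c₂ (C.edge m) ≠ some r := by
    intro m
    rw [hCedge]
    by_cases hm : m = i - 1
    · rw [hm, hC₁.unc]; simp
    · rcases hC₁.col m hm with h | h <;> rw [h] <;> simp [hrp.symm, hrq.symm]
  have hDr : ∀ m, c₂ (D.edge m) ≠ some r := by
    intro m
    rw [hDedge]
    by_cases hm : m = k - 1
    · rw [hm, hD₁.unc]; simp
    · rcases hD₁.col m hm with h | h <;> rw [h] <;> simp [hrp.symm, hrq.symm]
  have hCi : ∀ m, m ≠ i → C.z m ≠ C.z i := fun m h h' => h (C.inj h')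
  have hDk : ∀ m, m ≠ k → D.z m ≠ D.z k := fun m h h' => h (D.inj h')
  have hCp : i - 1 ≠ i := fun h => C.add_one_ne i (by linear_combination -h)
  have hDp : k - 1 ≠ k := fun h => D.add_one_ne k (by linear_combination -h)
  obtain ⟨E, hE, hEe, hEA⟩ := exists_absorbs (c := c₂) (C := C) (i := i) (q := q) (r := r) hO₂ hd
    (by rw [hCedge]; exact hC₁.unc) har₂
    (fun w hw => by rw [hsame₂' _ _ (hCi _ hCp) (hCneD _ _)]; exact haq w hw)
    (by rw [hCedge]; exact hC₁s) (hCr _) (hCr _)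
    (fun w hw hwC => by
      rw [hsame₂' _ _ (hCi _ (C.add_one_ne i)) (hCneD _ _)]; exact hCs _ w hw hwC)
    (fun w hw hwC => by rw [hsame₂' _ _ (hCi _ hCp) (hCneD _ _)]; exact hCs _ w hw hwC)
  obtain ⟨F, hF, hFe, hFA⟩ := exists_absorbs (c := c₂) (C := D) (i := k) (q := q) (r := r) hO₂ hd
    (by rw [hDedge]; exact hD₁.unc) hbr₂
    (fun w hw => by rw [hsame₂' _ _ (hCneD _ _).symm (hDk _ hDp)]; exact hbq w hw)
    (by rw [hDedge]; exact hD₁s) (hDr _) (hDr _)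
    (fun w hw hwD => by
      rw [hsame₂' _ _ (hCneD _ _).symm (hDk _ (D.add_one_ne k))]; exact hDs _ w hw hwD)
    (fun w hw hwD => by rw [hsame₂' _ _ (hCneD _ _).symm (hDk _ hDp)]; exact hDs _ w hw hwD)
  refine ⟨c₂, E, F, q, r, hO₂, hE, hF, hEe, hFe, hEA, hFA, by rw [hU₂, hU₁, hU₀], ?_⟩
  intro H m a b hH hHC hHD
  refine hH.congr fun v w hv _ => ?_
  have hvC : v ∉ C.verts := hH.disjoint hC hc hd hHC hv
  have hvD : v ∉ D.verts := hH.disjoint hD hc hd hHD hv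
  rw [hsame₂' v w (fun h => hvC (h ▸ C.z_mem _)) (fun h => hvD (h ▸ D.z_mem _)), hsame₁ v w hvD,
    hoff₀ _ (C.mk_ne_edge_of_left hvC)]

/-- If the alternating cycles `C` and `D` are joined by an edge `ab`, then the neighbours of `a`
on `C` have degree three, and a third neighbour of one of them is neither on an alternating cycle
other than `C` and `D`, nor equal or adjacent to `b` on `D`. -/
lemma Alternating.next_to_edge {C D : OddCycle G} {j : ZMod C.L} {l : ZMod D.L}
    {p q p' q' : Fin 3}
    (hC : Alternating c C j p q) (hD : Alternating c D l p' q') (hc : IsOptimal G c)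
    (hd : ∀ v, G.degree v ≤ 3) (hne : C.edge j ≠ D.edge l) {i : ZMod C.L} {k : ZMod D.L}
    (hadj : G.Adj (C.z i) (D.z k)) :
    (G.degree (C.z (i + 1)) = 3 ∧ G.degree (C.z (i - 1)) = 3) ∧
    ∀ w, w ∉ C.verts → G.Adj (C.z (i + 1)) w ∨ G.Adj (C.z (i - 1)) w →
      (w ≠ D.z k ∧ w ≠ D.z (k + 1) ∧ w ≠ D.z (k - 1)) ∧
      ∀ (H : OddCycle G) (m : ZMod H.L) (a b : Fin 3), Alternating c H m a b →
        H.edge m ≠ C.edge j → H.edge m ≠ D.edge l → w ∉ H.verts := by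
  obtain ⟨c₂, E, F, q, r, hO₂, hE, hF, hEe, hFe, hEA, hFA, hU, hkeep⟩ :=
    hC.switch hD hc hd hne hadj
  refine ⟨⟨hEA.succ_degree, hEA.pred_degree⟩, fun w hwC hw => ?_⟩
  have hwE : w ∈ E.verts := by
    rcases hw with hw | hw
    · exact hEA.succ_adj w hw hwC
    · exact hEA.pred_adj w hw hwC
  -- The third neighbour `w` lies on the cycle `E` after the switch, which is disjoint from all
  -- other alternating cycles of the new colouring.
  have hEF : E.edge (-1) ≠ F.edge (-1) := by
    rw [hEe, hFe]
    intro h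
    rcases D.eq_of_edge_eq (i := k - 1) h with ⟨h1, -⟩ | ⟨h1, -⟩
    · exact hC.disjoint hD hc hd hne (C.z_mem _) (h1 ▸ D.z_mem _)
    · exact hC.disjoint hD hc hd hne (C.z_mem _) (h1 ▸ D.z_mem _)
  have hwF := hE.disjoint hF hO₂ hd hEF hwE
  refine ⟨⟨fun h => hwF (h ▸ hFA.self), fun h => hwF (h ▸ hFA.succ), fun h => hwF (h ▸ hFA.pred)⟩,
    ?_⟩
  intro H m a b hH h1 h2
  refine hE.disjoint (hkeep H m a b hH h1 h2) hO₂ hd ?_ hwE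
  rw [hEe]
  intro h
  refine hC.disjoint hH hc hd h1.symm (C.z_mem (i - 1)) ?_
  rcases H.eq_of_edge_eq (i := m) h with ⟨h1, -⟩ | ⟨h1, -⟩ <;> rw [h1] <;> exact H.z_mem _

end ThreeColoring

/-! ### Closed walks of odd length and shortest odd cycles -/

namespace ThreeColoring

section OddGirth

variable {V : Type*} {G : SimpleGraph V}

/-- A closed walk of odd length contains an odd cycle. -/
lemma exists_odd_cycle (n : ℕ) : ∀ (v : V) (w : G.Walk v v), w.length = n → Odd n →
    ∃ (a : V) (w' : G.Walk a a), w'.IsCycle ∧ Odd w'.length ∧ w'.length ≤ n := by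
  induction n using Nat.strong_induction_on with
  | _ n ih =>
    intro v w hw hn
    cases w with
    | nil => subst hw; simp at hn
    | cons h p =>
      rw [SimpleGraph.Walk.length_cons] at hw
      by_cases hp : p.IsPath
      · refine ⟨v, .cons h p, ?_, by rwa [SimpleGraph.Walk.length_cons, hw], by
          rw [SimpleGraph.Walk.length_cons, hw]⟩
        rw [SimpleGraph.Walk.cons_isCycle_iff]
        refine ⟨hp, fun he => ?_⟩
        rw [Sym2.eq_swap] at he
        have := hp.length_eq_one_of_mem_edges he
        rw [← hw, this] at hn
        exact absurd hn (by decide)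
      · rw [SimpleGraph.Walk.isPath_iff_isSubwalk_imp_nil] at hp
        push Not at hp
        obtain ⟨u, q, ⟨r, s, hrs⟩, hq⟩ := hp
        have hlen : p.length = r.length + q.length + s.length := by
          rw [hrs, SimpleGraph.Walk.length_append, SimpleGraph.Walk.length_append]
        have hq0 : 0 < q.length := by
          rwa [SimpleGraph.Walk.not_nil_iff_lt_length] at hq
        by_cases hodd : Odd q.length
        · obtain ⟨a, w', h1, h2, h3⟩ := ih q.length (by omega) u q rfl hodd
          exact ⟨a, w', h1, h2, by omega⟩
        · obtain ⟨a, w', h1, h2, h3⟩ := ih (n - q.length) (by omega) v (.cons h (r.append s)) (by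
            rw [SimpleGraph.Walk.length_cons, SimpleGraph.Walk.length_append]; omega)
            (by rw [Nat.odd_iff] at hn hodd ⊢; omega)
          exact ⟨a, w', h1, h2, by omega⟩

lemma oddGirth_le_of_odd {v : V} (w : G.Walk v v) (hw : Odd w.length) :
    oddGirth G ≤ (w.length : ℕ∞) := by
  obtain ⟨a, w', h1, h2, h3⟩ := exists_odd_cycle w.length v w rfl hw
  refine (iInf_le_of_le a (iInf_le_of_le w' (iInf_le_of_le h1 (iInf_le_of_le h2 le_rfl)))).trans ?_
  exact_mod_cast h3

/-- The odd girth of `G` is at least `g`, in terms of closed walks. -/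
def OddWalksGE (G : SimpleGraph V) (g : ℕ) : Prop :=
  ∀ (v : V) (w : G.Walk v v), Odd w.length → g ≤ w.length

namespace OddCycle

variable (C : OddCycle G)

lemma exists_walk (i : ZMod C.L) (n : ℕ) : ∃ w : G.Walk (C.z i) (C.z (i + n)), w.length = n := by
  induction n with
  | zero => exact ⟨SimpleGraph.Walk.nil.copy rfl (by simp), by simp⟩
  | succ n ih =>
    obtain ⟨w, hw⟩ := ih
    have h := C.adj (i + n)
    have e : i + n + 1 = i + ((n + 1 : ℕ) : ZMod C.L) := by push_cast; ring
    rw [e] at h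
    exact ⟨w.concat h, by rw [SimpleGraph.Walk.length_concat, hw]⟩

/-- There is a walk along the cycle in either direction. -/
lemma exists_walks (i k : ZMod C.L) :
    (∃ w : G.Walk (C.z i) (C.z k), w.length = (k - i).val) ∧
    ∃ w : G.Walk (C.z i) (C.z k), w.length = C.L - (k - i).val := by
  have hlt := ZMod.val_lt (k - i)
  constructor
  · obtain ⟨w, hw⟩ : ∃ w : G.Walk (C.z i) (C.z k), w.length = (k - i).val := by
      have := C.exists_walk i (k - i).val
      rwa [ZMod.natCast_val, ZMod.cast_id, add_sub_cancel] at this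
    exact ⟨w, hw⟩
  · have h2 := C.exists_walk k (C.L - (k - i).val)
    rw [Nat.cast_sub hlt.le, ZMod.natCast_val, ZMod.cast_id, ZMod.natCast_self] at h2
    have e : k + (0 - (k - i)) = i := by ring
    rw [e] at h2
    obtain ⟨w, hw⟩ := h2
    exact ⟨w.reverse, by rw [SimpleGraph.Walk.length_reverse, hw]⟩

lemma le_length {g : ℕ} (hg : OddWalksGE G g) : g ≤ C.L := by
  have := C.exists_walk 0 C.L
  rw [ZMod.natCast_self, add_zero] at this
  obtain ⟨w, hw⟩ := this
  rw [← hw]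
  exact hg _ w (by rw [hw]; exact C.odd)

variable {C}

/-- In a shortest odd cycle, a walk between two of its vertices whose length has the parity of
one of the two arcs is at least as long as that arc. -/
lemma walk_bounds (hg : OddWalksGE G C.L) {i k : ZMod C.L} (P : G.Walk (C.z k) (C.z i)) :
    (Odd ((k - i).val + P.length) → C.L ≤ (k - i).val + P.length) ∧
    (Even ((k - i).val + P.length) → (k - i).val ≤ P.length) := by
  obtain ⟨⟨w, hw⟩, ⟨w', hw'⟩⟩ := C.exists_walks i k
  have hlt := ZMod.val_lt (k - i)
  have hodd := C.odd
  constructor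
  · intro h
    have := hg _ (w.append P)
    rw [SimpleGraph.Walk.length_append, hw] at this
    exact this h
  · intro h
    have := hg _ (w'.append P)
    rw [SimpleGraph.Walk.length_append, hw'] at this
    have := this (by rw [Nat.odd_iff] at hodd ⊢; rw [Nat.even_iff] at h; omega)
    omega

lemma eq_add_of_val {i k : ZMod C.L} {n : ℕ} (h : (k - i).val = n) : k = i + n := by
  rw [← h, ZMod.natCast_val, ZMod.cast_id]; ring

lemma eq_sub_of_val {i k : ZMod C.L} {n : ℕ} (hn : n ≤ C.L) (h : (k - i).val = C.L - n) :
    k = i - n := by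
  have := eq_add_of_val h
  rw [Nat.cast_sub hn, ZMod.natCast_self] at this
  rw [this]; ring

/-- A shortest odd cycle has no chords. -/
lemma eq_of_adj (hg : OddWalksGE G C.L) {i k : ZMod C.L} (h : G.Adj (C.z i) (C.z k)) :
    k = i + 1 ∨ k = i - 1 := by
  obtain ⟨h1, h2⟩ := walk_bounds hg (SimpleGraph.Walk.cons h.symm SimpleGraph.Walk.nil)
  simp only [SimpleGraph.Walk.length_cons, SimpleGraph.Walk.length_nil, zero_add] at h1 h2
  have hlt := ZMod.val_lt (k - i)
  have h3 := C.three_le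
  have h0 : (k - i).val ≠ 0 := by
    intro h0
    have := eq_add_of_val h0
    rw [Nat.cast_zero, add_zero] at this
    exact h.ne (by rw [this])
  rw [Nat.odd_iff] at h1
  rw [Nat.even_iff] at h2
  rcases Nat.mod_two_eq_zero_or_one (k - i).val with h4 | h4
  · right
    have := h1 (by omega)
    simpa using eq_sub_of_val (C := C) (i := i) (k := k) (n := 1) (by omega) (by omega)
  · left
    have := h2 (by omega)
    simpa using eq_add_of_val (C := C) (i := i) (k := k) (n := 1) (by omega)

lemma stub_notMem (hg : OddWalksGE G C.L) {i : ZMod C.L} {w : V} (h : G.Adj (C.z i) w)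
    (h1 : w ≠ C.z (i + 1)) (h2 : w ≠ C.z (i - 1)) : w ∉ C.verts := by
  rintro ⟨k, rfl⟩
  rcases eq_of_adj hg h with rfl | rfl
  · exact h1 rfl
  · exact h2 rfl

/-- If adjacent vertices outside a shortest odd cycle `D` have neighbours on `D` that are neither
equal nor adjacent, then these have distance three on `D`. -/
lemma three_apart {D : OddCycle G} (hg : OddWalksGE G D.L) {x y : V} {k l : ZMod D.L}
    (hx : G.Adj x (D.z k)) (hy : G.Adj y (D.z l)) (hxy : G.Adj x y)
    (h0 : l ≠ k) (h1 : l ≠ k + 1) (h2 : l ≠ k - 1) : l = k + 3 ∨ l = k - 3 := by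
  obtain ⟨b1, b2⟩ := walk_bounds hg
    (SimpleGraph.Walk.cons hy.symm (.cons hxy.symm (.cons hx .nil)))
  simp only [SimpleGraph.Walk.length_cons, SimpleGraph.Walk.length_nil, zero_add] at b1 b2
  have hlt := ZMod.val_lt (l - k)
  have h3 := D.three_le
  have hodd := D.odd
  have n0 : (l - k).val ≠ 0 := fun h => h0 (by simpa using eq_add_of_val h)
  have n1 : (l - k).val ≠ 1 := fun h => h1 (by simpa using eq_add_of_val h)
  have n2 : (l - k).val ≠ D.L - 1 := fun h => h2 (by
    simpa using eq_sub_of_val (C := D) (by omega) h)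
  rw [Nat.odd_iff] at b1 hodd
  rw [Nat.even_iff] at b2
  rcases Nat.mod_two_eq_zero_or_one (l - k).val with h4 | h4
  · right
    have := b1 (by omega)
    simpa using eq_sub_of_val (C := D) (i := k) (k := l) (n := 3) (by omega) (by omega)
  · left
    have := b2 (by omega)
    simpa using eq_add_of_val (C := D) (i := k) (k := l) (n := 3) (by omega)

/-- Three consecutive vertices outside a shortest odd cycle `D` with neighbours on `D`, of which
consecutive ones are neither equal nor adjacent, force `D` to be a pentagon: the steps between
the neighbours are `±3`, and two steps of the same sign give a closed odd walk of length
`|D| - 2`. -/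
lemma length_eq_five {D : OddCycle G} (hg : OddWalksGE G D.L) {x y u : V} {k l m : ZMod D.L}
    (hx : G.Adj x (D.z k)) (hy : G.Adj y (D.z l)) (hu : G.Adj u (D.z m)) (hxy : G.Adj x y)
    (hyu : G.Adj y u) (h0 : l ≠ k) (h1 : l ≠ k + 1) (h2 : l ≠ k - 1)
    (h0' : m ≠ l) (h1' : m ≠ l + 1) (h2' : m ≠ l - 1) (hkm : m ≠ k) : D.L = 5 := by
  have h3 := D.three_le
  have hodd := D.odd
  have step1 := three_apart hg hx hy hxy h0 h1 h2
  have step2 := three_apart hg hy hu hyu h0' h1' h2'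
  have hne3 : D.L ≠ 3 := by
    intro h
    have : ((3 : ℕ) : ZMod D.L) = 0 := by rw [← h]; exact ZMod.natCast_self _
    push_cast at this
    rcases step1 with h | h <;> rw [this] at h <;> simp at h <;> exact h0 h
  by_contra hne5
  have hL : 7 ≤ D.L := by
    rw [Nat.odd_iff] at hodd; omega
  obtain ⟨b1, b2⟩ := walk_bounds hg
    (SimpleGraph.Walk.cons hu.symm (.cons hyu.symm (.cons hxy.symm (.cons hx .nil))))
  simp only [SimpleGraph.Walk.length_cons, SimpleGraph.Walk.length_nil, zero_add] at b1 b2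
  have hval6 : (6 : ZMod D.L).val = 6 := by
    have := ZMod.val_cast_of_lt (n := D.L) (a := 6) (by omega)
    simpa using this
  have h6 : (6 : ZMod D.L) ≠ 0 := fun h => by rw [h] at hval6; simp at hval6
  have : m - k = 6 ∨ m - k = -6 := by
    rcases step1 with h | h <;> rcases step2 with h' | h'
    · left; rw [h', h]; ring
    · exact absurd (by rw [h', h]; ring) hkm
    · exact absurd (by rw [h', h]; ring) hkm
    · right; rw [h', h]; ring
  rw [Nat.odd_iff] at b1 hodd
  rw [Nat.even_iff] at b2
  rcases this with h | h
  · rw [h, hval6] at b2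
    have := b2 (by omega)
    omega
  · rw [h, ZMod.neg_val, if_neg h6, hval6] at b1
    have := b1 (by omega)
    omega

end OddCycle

end OddGirth

end ThreeColoring

/-! ### Extremal colourings -/

namespace ThreeColoring

variable {V : Type*} [Fintype V] [DecidableEq V] {G : SimpleGraph V} [DecidableRel G.Adj]
  {c c' : Sym2 V → Option (Fin 3)}

namespace OddCycle

variable (C : OddCycle G)

/-- The set of vertices of a cycle as a `Finset`. -/
def vset : Finset V := Finset.univ.image C.z

lemma mem_vset {v : V} : v ∈ C.vset ↔ v ∈ C.verts := by
  simp [vset, verts]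

lemma card_vset : C.vset.card = C.L := by
  rw [vset, Finset.card_image_of_injective _ C.inj, Finset.card_univ, ZMod.card]

lemma length_le_card : C.L ≤ Fintype.card V := by
  rw [← C.card_vset]; exact Finset.card_le_univ _

end OddCycle

/-- The lengths of the alternating cycles of the colouring `c` through the uncoloured edge `e`. -/
def altLengths (G : SimpleGraph V) (c : Sym2 V → Option (Fin 3)) (e : Sym2 V) : Set ℕ :=
  {n | ∃ (C : OddCycle G) (j : ZMod C.L) (p q : Fin 3),
    Alternating c C j p q ∧ C.edge j = e ∧ C.L = n}

/-- The largest length of an alternating cycle of the colouring `c` through the uncoloured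
edge `e`. -/
noncomputable def cycleLen (G : SimpleGraph V) (c : Sym2 V → Option (Fin 3)) (e : Sym2 V) : ℕ :=
  sSup (altLengths G c e)

lemma bddAbove_altLengths (e : Sym2 V) : BddAbove (altLengths G c e) := by
  refine ⟨Fintype.card V, ?_⟩
  rintro n ⟨C, j, p, q, -, -, rfl⟩
  exact C.length_le_card

lemma Alternating.le_cycleLen {C : OddCycle G} {j : ZMod C.L} {p q : Fin 3}
    (h : Alternating c C j p q) : C.L ≤ cycleLen G c (C.edge j) :=
  le_csSup (bddAbove_altLengths _) ⟨C, j, p, q, h, rfl, rfl⟩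

lemma IsOptimal.exists_alternating_of_mem (hc : IsOptimal G c) (hd : ∀ v, G.degree v ≤ 3)
    {e : Sym2 V} (he : e ∈ uncolored G c) : ∃ (C : OddCycle G) (j : ZMod C.L) (p q : Fin 3),
    Alternating c C j p q ∧ C.edge j = e := by
  induction e using Sym2.ind with
  | _ x y =>
    rw [mem_uncolored_mk] at he
    obtain ⟨p, hp⟩ := exists_missing (hd x) he.1 he.2
    obtain ⟨q, hq⟩ := exists_missing (c := c) (hd y) he.1.symm (by rw [Sym2.eq_swap, he.2])
    obtain ⟨C, hC, h0, h1⟩ := hc.exists_alternating he.1 he.2 hp hq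
    exact ⟨C, -1, p, q, hC, by rw [OddCycle.edge, neg_add_cancel, h0, h1, Sym2.eq_swap]⟩

lemma IsOptimal.exists_longest (hc : IsOptimal G c) (hd : ∀ v, G.degree v ≤ 3)
    {e : Sym2 V} (he : e ∈ uncolored G c) : ∃ (C : OddCycle G) (j : ZMod C.L) (p q : Fin 3),
    Alternating c C j p q ∧ C.edge j = e ∧ C.L = cycleLen G c e := by
  obtain ⟨C, j, p, q, hC, hCe⟩ := hc.exists_alternating_of_mem hd he
  have hne : (altLengths G c e).Nonempty := ⟨C.L, C, j, p, q, hC, hCe, rfl⟩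
  exact Nat.sSup_mem hne (bddAbove_altLengths e)

open Classical in
/-- The weight of an uncoloured edge: twice the largest length of an alternating cycle through
it, plus one if the edge has an end of degree at most two. -/
noncomputable def weight (G : SimpleGraph V) [DecidableRel G.Adj] (c : Sym2 V → Option (Fin 3))
    (e : Sym2 V) : ℕ :=
  2 * cycleLen G c e + if ∃ v ∈ e, G.degree v ≤ 2 then 1 else 0

/-- A minimal colouring is extremal if the total weight of its uncoloured edges is as large as
possible. -/
def IsExtremal (G : SimpleGraph V) [DecidableRel G.Adj] (c : Sym2 V → Option (Fin 3)) : Prop :=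
  IsOptimal G c ∧ ∀ c', IsOptimal G c' →
    ∑ e ∈ uncolored G c', weight G c' e ≤ ∑ e ∈ uncolored G c, weight G c e

lemma exists_isExtremal : ∃ c, IsExtremal G c := by
  obtain ⟨c, hc, hmax⟩ := Set.exists_max_image {c | IsOptimal G c}
    (fun c => ∑ e ∈ uncolored G c, weight G c e) (Set.toFinite _) exists_isOptimal
  exact ⟨c, hc, hmax⟩

lemma IsOptimal.weight_le (hc : IsOptimal G c) (hd : ∀ v, G.degree v ≤ 3) {e : Sym2 V}
    (he : e ∈ uncolored G c)
    (h : ∀ (C : OddCycle G) (j : ZMod C.L) (p q : Fin 3), Alternating c C j p q → C.edge j = e →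
      Alternating c' C j p q) : weight G c e ≤ weight G c' e := by
  obtain ⟨C, j, p, q, hC, rfl, hlen⟩ := hc.exists_longest hd he
  have := (h C j p q hC rfl).le_cycleLen
  unfold weight
  omega

/-- In an extremal colouring, if a longest alternating cycle contains a vertex of degree two,
then its uncoloured edge is at such a vertex: otherwise moving the uncoloured edge there would
increase the weight. -/
lemma IsExtremal.exists_degree_le_two (hc : IsExtremal G c) (hd : ∀ v, G.degree v ≤ 3)
    {C : OddCycle G} {j : ZMod C.L} {p q : Fin 3} (hC : Alternating c C j p q)
    (hlen : C.L = cycleLen G c (C.edge j)) {i : ZMod C.L} (hi : G.degree (C.z i) ≤ 2) :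
    ∃ v ∈ C.edge j, G.degree v ≤ 2 := by
  by_contra hcon
  obtain ⟨c', hc', hC', -, -, hoff, hU⟩ := hC.rotate hc.1 i
  have hle := hc.2 c' hc'
  have hj : C.edge j ∈ uncolored G c := mem_uncolored.2 ⟨C.edge_mem j, hC.unc⟩
  have hnot : C.edge i ∉ (uncolored G c).erase (C.edge j) := by
    rw [Finset.mem_erase, mem_uncolored]
    rintro ⟨h1, -, h2⟩
    exact h1 (congrArg C.edge (hC.eq_of_unc h2))
  rw [hU, Finset.sum_insert hnot, ← Finset.add_sum_erase _ _ hj] at hle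
  have hsum : ∑ e ∈ (uncolored G c).erase (C.edge j), weight G c e ≤
      ∑ e ∈ (uncolored G c).erase (C.edge j), weight G c' e := by
    refine Finset.sum_le_sum fun e he => ?_
    rw [Finset.mem_erase] at he
    refine hc.1.weight_le hd he.2 ?_
    rintro D l p' q' hD rfl
    refine hD.congr fun v w hv _ => hoff _ (C.mk_ne_edge_of_left ?_)
    exact hD.disjoint hC hc.1 hd he.1 hv
  have h1 : weight G c (C.edge j) = 2 * C.L := by
    rw [weight, if_neg hcon, hlen, add_zero]
  have h2 : 2 * C.L + 1 ≤ weight G c' (C.edge i) := by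
    have := hC'.le_cycleLen
    rw [weight, if_pos ⟨C.z i, by simp [OddCycle.edge], hi⟩]
    omega
  omega

/-- In an extremal colouring the switch of two longest alternating cycles does not increase the
total length of the two cycles by more than one, where one accounts for the two units of weight
that the uncoloured edges may lose if they had ends of degree two. -/
lemma IsExtremal.switch (hc : IsExtremal G c) (hd : ∀ v, G.degree v ≤ 3)
    {C D : OddCycle G} {j : ZMod C.L} {l : ZMod D.L} {p q p' q' : Fin 3}
    (hC : Alternating c C j p q) (hD : Alternating c D l p' q')
    (hlC : C.L = cycleLen G c (C.edge j)) (hlD : D.L = cycleLen G c (D.edge l))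
    (hne : C.edge j ≠ D.edge l) {i : ZMod C.L} {k : ZMod D.L}
    (hadj : G.Adj (C.z i) (D.z k)) :
    ∃ E F : OddCycle G, Absorbs C i E ∧ Absorbs D k F ∧ E.L + F.L ≤ C.L + D.L + 1 := by
  obtain ⟨c₂, E, F, q₂, r₂, hO₂, hE, hF, hEe, hFe, hEA, hFA, hU, hkeep⟩ :=
    hC.switch hD hc.1 hd hne hadj
  refine ⟨E, F, hEA, hFA, ?_⟩
  have hle := hc.2 c₂ hO₂
  have hCD : ∀ m n, C.edge m ≠ D.edge n := by
    intro m n h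
    refine hC.disjoint hD hc.1 hd hne (C.z_mem m) ?_
    rcases D.eq_of_edge_eq (i := n) h with ⟨h1, -⟩ | ⟨h1, -⟩ <;> rw [h1] <;> exact D.z_mem _
  have hCU : C.edge j ∈ uncolored G c := mem_uncolored.2 ⟨C.edge_mem j, hC.unc⟩
  have hDU : D.edge l ∈ (uncolored G c).erase (C.edge j) :=
    Finset.mem_erase.2 ⟨hne.symm, mem_uncolored.2 ⟨D.edge_mem l, hD.unc⟩⟩
  set R := ((uncolored G c).erase (C.edge j)).erase (D.edge l) with hR
  have hU' : uncolored G c₂ = insert (D.edge (k - 1)) (insert (C.edge (i - 1)) R) := by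
    rw [hU, Finset.erase_insert_of_ne (hCD _ _)]
  have hn1 : C.edge (i - 1) ∉ R := by
    rw [hR, Finset.mem_erase, Finset.mem_erase, mem_uncolored]
    rintro ⟨-, h1, -, h2⟩
    exact h1 (congrArg C.edge (hC.eq_of_unc h2))
  have hn2 : D.edge (k - 1) ∉ insert (C.edge (i - 1)) R := by
    rw [Finset.mem_insert, hR, Finset.mem_erase, Finset.mem_erase, mem_uncolored]
    rintro (h | ⟨h1, -, -, h2⟩)
    · exact hCD _ _ h.symm
    · exact h1 (congrArg D.edge (hD.eq_of_unc h2))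
  rw [hU', Finset.sum_insert hn2, Finset.sum_insert hn1, ← Finset.add_sum_erase _ _ hCU,
    ← Finset.add_sum_erase _ _ hDU, ← hR] at hle
  have hsum : ∑ e ∈ R, weight G c e ≤ ∑ e ∈ R, weight G c₂ e := by
    refine Finset.sum_le_sum fun e he => ?_
    rw [hR, Finset.mem_erase, Finset.mem_erase] at he
    refine hc.1.weight_le hd he.2.2 ?_
    rintro H m a b hH rfl
    exact hkeep H m a b hH he.2.1 he.1
  have h1 : weight G c (C.edge j) ≤ 2 * C.L + 1 := by
    rw [weight, ← hlC]; split_ifs <;> omega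
  have h2 : weight G c (D.edge l) ≤ 2 * D.L + 1 := by
    rw [weight, ← hlD]; split_ifs <;> omega
  have h3 : 2 * E.L ≤ weight G c₂ (C.edge (i - 1)) := by
    have := hE.le_cycleLen
    rw [hEe] at this
    rw [weight]; omega
  have h4 : 2 * F.L ≤ weight G c₂ (D.edge (k - 1)) := by
    have := hF.le_cycleLen
    rw [hFe] at this
    rw [weight]; omega
  omega

/-- In an extremal colouring of a graph without triangles, let two pentagons among the longest
alternating cycles be joined by edges at consecutive vertices of the first one. Then the third
neighbour of the vertex before these lies on one of the two pentagons: otherwise the switch would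
turn the first pentagon into a longer cycle. -/
lemma IsExtremal.mem_of_pentagons (hc : IsExtremal G c) (hd : ∀ v, G.degree v ≤ 3)
    (hg : OddWalksGE G 5) {C D : OddCycle G} {j : ZMod C.L} {l : ZMod D.L} {p q p' q' : Fin 3}
    (hC : Alternating c C j p q) (hD : Alternating c D l p' q')
    (hlC : C.L = cycleLen G c (C.edge j)) (hlD : D.L = cycleLen G c (D.edge l))
    (hne : C.edge j ≠ D.edge l) (hC5 : C.L = 5) (hD5 : D.L = 5) {i : ZMod C.L} {k k' : ZMod D.L}
    (hadj : G.Adj (C.z i) (D.z k)) (hadj' : G.Adj (C.z (i + 1)) (D.z k')) {w : V}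
    (hw : G.Adj (C.z (i - 1)) w) (hwC : w ∉ C.verts) : w ∈ D.verts := by
  by_contra hwD
  obtain ⟨E, F, hEA, hFA, hlen⟩ := hc.switch hd hC hD hlC hlD hne hadj
  have hCD : ∀ v, v ∈ C.verts → v ∉ D.verts := fun v hv => hC.disjoint hD hc.1 hd hne hv
  have hDC : ∀ m, D.z m ∉ C.verts := fun m h => hCD _ h (D.z_mem m)
  have hE5 := E.le_length hg
  have hF5 := F.le_length hg
  have hEodd := E.odd
  have hEL : E.L = 5 := by
    rw [Nat.odd_iff] at hEodd; omega
  -- The five vertices that `E` contains in any case fill `E`.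
  have hu : D.z k' ∈ E.verts := hEA.succ_adj _ hadj' (hDC k')
  have hwE : w ∈ E.verts := hEA.pred_adj _ hw hwC
  have hvset : E.vset = {w, C.z (i - 1), C.z i, C.z (i + 1), D.z k'} := by
    symm
    apply Finset.eq_of_subset_of_card_le
    · intro v hv
      simp only [Finset.mem_insert, Finset.mem_singleton] at hv
      rw [E.mem_vset]
      rcases hv with rfl | rfl | rfl | rfl | rfl
      exacts [hwE, hEA.pred, hEA.self, hEA.succ, hu]
    · rw [E.card_vset, hEL]
      have e1 : w ≠ C.z (i - 1) := fun h => hwC (h ▸ C.z_mem _)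
      have e2 : w ≠ C.z i := fun h => hwC (h ▸ C.z_mem _)
      have e3 : w ≠ C.z (i + 1) := fun h => hwC (h ▸ C.z_mem _)
      have e4 : w ≠ D.z k' := fun h => hwD (h ▸ D.z_mem _)
      have e5 : C.z (i - 1) ≠ C.z i := (C.adj_sub i).ne.symm
      have e6 := (C.z_succ_ne_pred i).symm
      have e7 := (C.adj i).ne
      have e8 : ∀ m, C.z m ≠ D.z k' := fun m h => hDC k' (h ▸ C.z_mem _)
      rw [Finset.card_insert_of_notMem (by simp [e1, e2, e3, e4]),
        Finset.card_insert_of_notMem (by simp [e5, e6, e8]),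
        Finset.card_insert_of_notMem (by simp [e7, e8]),
        Finset.card_insert_of_notMem (by simp [e8]), Finset.card_singleton]
  -- But the vertex `D.z k'` has no neighbour among them other than `C.z (i + 1)`.
  obtain ⟨m, hm⟩ := hu
  have hnbr : ∀ v, G.Adj (D.z k') v → v ∈ E.verts → v = C.z (i + 1) := by
    intro v hv hvE
    rw [← E.mem_vset, hvset] at hvE
    have hcases := eq_or_eq_or_eq_of_degree_le (hd _) hadj'.symm (D.adj k') (D.adj_sub k')
      (fun h => hDC _ (h ▸ C.z_mem _)) (fun h => hDC _ (h ▸ C.z_mem _)) (D.z_succ_ne_pred k') hv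
    rcases hcases with h | h
    · exact h
    · have hvD : v ∈ D.verts := by rcases h with rfl | rfl <;> exact D.z_mem _
      simp only [Finset.mem_insert, Finset.mem_singleton] at hvE
      rcases hvE with rfl | rfl | rfl | rfl | rfl
      · exact absurd hvD hwD
      · exact absurd hvD (hCD _ (C.z_mem _))
      · exact absurd hvD (hCD _ (C.z_mem _))
      · rfl
      · exact absurd rfl hv.ne
  have a1 := E.adj m
  have a2 := E.adj_sub m
  rw [hm] at a1 a2
  exact E.z_succ_ne_pred m ((hnbr _ a1 (E.z_mem _)).trans (hnbr _ a2 (E.z_mem _)).symm)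

end ThreeColoring

/-! ### Vertices of degree two and the second alternating cycle -/

namespace ThreeColoring

variable {V : Type*} [Fintype V] [DecidableEq V] {G : SimpleGraph V} [DecidableRel G.Adj]
  {c : Sym2 V → Option (Fin 3)}

namespace Alternating

variable {C : OddCycle G} {j : ZMod C.L} {p q r : Fin 3}

lemma missing_third (hC : Alternating c C j p q) (hd : ∀ v, G.degree v ≤ 3) (hrp : r ≠ p)
    (hrq : r ≠ q) {i : ZMod C.L} (hi : G.degree (C.z i) ≤ 2) : Missing G c (C.z i) r := by
  have hedge : ∀ m, c (C.edge m) ≠ some r := by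
    intro m
    by_cases hm : m = j
    · rw [hm, hC.unc]; simp
    · rcases hC.col m hm with h | h <;> rw [h] <;> simp [hrp.symm, hrq.symm]
  intro w hw hcw
  by_cases h1 : w = C.z (i + 1)
  · rw [h1] at hcw; exact hedge _ hcw
  · by_cases h2 : w = C.z (i - 1)
    · rw [h2, ← C.edge_sub_one] at hcw; exact hedge _ hcw
    · have := C.degree_eq_three hd hw h1 h2
      omega

/-- Two vertices of degree two on an alternating cycle of a minimal colouring are not
consecutive. -/
lemma degree_succ (hC : Alternating c C j p q) (hc : IsOptimal G c) (hd : ∀ v, G.degree v ≤ 3)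
    {i : ZMod C.L} (hi : G.degree (C.z i) ≤ 2) : G.degree (C.z (i + 1)) = 3 := by
  by_contra h
  obtain ⟨r, hrp, hrq, -⟩ := exists_third hC.ne
  obtain ⟨c', hc', hC', -⟩ := hC.rotate hc i
  have h' : G.degree (C.z (i + 1)) ≤ 2 := by have := hd (C.z (i + 1)); omega
  exact hc'.not_missing (C.adj i) hC'.unc (hC'.missing_third hd hrp hrq hi)
    (hC'.missing_third hd hrp hrq h')

lemma degree_pred (hC : Alternating c C j p q) (hc : IsOptimal G c) (hd : ∀ v, G.degree v ≤ 3)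
    {i : ZMod C.L} (hi : G.degree (C.z i) ≤ 2) : G.degree (C.z (i - 1)) = 3 := by
  by_contra h
  have h' : G.degree (C.z (i - 1)) ≤ 2 := by have := hd (C.z (i - 1)); omega
  have := hC.degree_succ hc hd h'
  rw [sub_add_cancel] at this
  omega

/-- If the uncoloured edge of an alternating cycle `C` has an end of degree two, then it lies on
a second alternating cycle `D`, which has one colour in common with `C` and which avoids all other
vertices of degree two of `C`. -/
lemma exists_second (hC : Alternating c C j p q) (hc : IsOptimal G c) (hd : ∀ v, G.degree v ≤ 3)
    (hy : ∃ v ∈ C.edge j, G.degree v ≤ 2) :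
    ∃ (D : OddCycle G) (l : ZMod D.L) (k k' r : Fin 3) (i₀ i₁ i₂ : ZMod C.L),
      Alternating c C j k k' ∧ Alternating c D l k r ∧ D.edge l = C.edge j ∧ r ≠ k' ∧
      (∀ i, G.degree (C.z i) ≤ 2 → i ≠ i₀ → C.z i ∉ D.verts) ∧ i₁ ≠ i₂ ∧
      C.z i₁ ∈ D.verts ∧ C.z i₂ ∈ D.verts ∧ G.degree (C.z i₁) = 3 ∧ G.degree (C.z i₂) = 3 := by
  -- At the end `i₀` of degree two the third colour `r` is missing, and at the other end `i₁` the
  -- colour `k` is: the second cycle is the one in these two colours.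
  have main : ∀ (k k' r : Fin 3) (i₀ i₁ i₂ : ZMod C.L), Alternating c C j k k' → r ≠ k → r ≠ k' →
      C.edge j = s(C.z i₁, C.z i₀) → i₁ ≠ i₂ → G.degree (C.z i₀) ≤ 2 → G.degree (C.z i₁) = 3 →
      G.degree (C.z i₂) = 3 → Missing G c (C.z i₁) k → G.Adj (C.z i₀) (C.z i₂) →
      c s(C.z i₀, C.z i₂) = some k →
      ∃ (D : OddCycle G) (l : ZMod D.L), Alternating c D l k r ∧ D.edge l = C.edge j ∧
      (∀ i, G.degree (C.z i) ≤ 2 → i ≠ i₀ → C.z i ∉ D.verts) ∧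
      C.z i₁ ∈ D.verts ∧ C.z i₂ ∈ D.verts := by
    intro k k' r i₀ i₁ i₂ hC hrk hrk' he h12 hi0 hi1 hi2 hm hadj hcol
    have hadj1 : G.Adj (C.z i₁) (C.z i₀) := by
      have := C.edge_mem j
      rwa [he] at this
    obtain ⟨D, hD, h0, h1⟩ := hc.exists_alternating hadj1 (by rw [← he, hC.unc]) hm
      (hC.missing_third hd hrk hrk' hi0)
    refine ⟨D, -1, hD, ?_, ?_, ⟨0, h0⟩, hD.mem_of_color ⟨-1, h1⟩ hadj (Or.inl hcol)⟩
    · rw [he, OddCycle.edge, neg_add_cancel, h0, h1, Sym2.eq_swap]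
    · rintro i hi hne ⟨m, hm⟩
      have hmr := hC.missing_third hd hrk hrk' hi
      rw [← hm] at hmr
      refine (hD.not_missing hc.1 (i := m) ?_ ?_).2 hmr
      · rintro rfl
        exact hne (C.inj (hm.symm.trans h1))
      · rw [neg_add_cancel]
        rintro rfl
        have := C.inj (hm.symm.trans h0)
        rw [this] at hi; omega
  have hends : ∃ k k', Alternating c C j k k' ∧ c (C.edge (j + 1)) = some k' ∧
      c (C.edge (j - 1)) = some k ∧ Missing G c (C.z j) k' ∧ Missing G c (C.z (j + 1)) k := by
    rcases hC.missing_ends hc with h | h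
    · exact ⟨q, p, hC.swap, h.1, h.2⟩
    · exact ⟨p, q, hC, h.1, h.2⟩
  obtain ⟨k, k', hC, hs, hp, hmj, hmj'⟩ := hends
  obtain ⟨r, hrk, hrk', -⟩ := exists_third hC.ne
  obtain ⟨v, hv, hdv⟩ := hy
  rcases Sym2.mem_iff.1 hv with rfl | rfl
  · have h1 := hC.degree_succ hc hd hdv
    have h2 := hC.degree_pred hc hd hdv
    obtain ⟨D, l, a1, a2, a3, a4, a5⟩ := main k k' r j (j + 1) (j - 1) hC hrk hrk' Sym2.eq_swap
      (C.add_one_ne_sub_one j) hdv h1 h2 hmj' (C.adj_sub j) (by rw [← C.edge_sub_one, hp])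
    exact ⟨D, l, k, k', r, _, _, _, hC, a1, a2, hrk', a3, C.add_one_ne_sub_one j, a4, a5, h1, h2⟩
  · have h1 := hC.degree_pred hc hd hdv
    have h2 := hC.degree_succ hc hd hdv
    rw [add_sub_cancel_right] at h1
    have hne : j ≠ j + 1 + 1 := fun h => zmod_two_ne_zero C.three_le (by linear_combination -h)
    obtain ⟨D, l, a1, a2, a3, a4, a5⟩ := main k' k r (j + 1) j (j + 1 + 1) hC.swap hrk' hrk rfl
      hne hdv h1 h2 hmj (C.adj _) hs
    exact ⟨D, l, k', k, r, _, _, _, hC.swap, a1, a2, hrk, a3, hne, a4, a5, h1, h2⟩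

/-- The indices of the vertices of degree two on a cycle. -/
def _root_.ThreeColoring.OddCycle.degTwo (C : OddCycle G) : Finset (ZMod C.L) :=
  Finset.univ.filter fun i => G.degree (C.z i) ≤ 2

/-- The size of the second alternating cycle `D` of an uncoloured edge with an end of degree two.
A vertex of degree two of `C` that is not on `D` takes with it its neighbour along the colour
that the two cycles have in common. -/
lemma exists_second_card (hC : Alternating c C j p q) (hc : IsOptimal G c)
    (hd : ∀ v, G.degree v ≤ 3) (hy : ∃ v ∈ C.edge j, G.degree v ≤ 2) :
    ∃ (D : OddCycle G) (l : ZMod D.L) (a b : Fin 3), Alternating c D l a b ∧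
      D.edge l = C.edge j ∧ D.L + 2 * C.degTwo.card ≤ C.L + (D.vset \ C.vset).card + 2 ∧
      (OddWalksGE G C.L → 2 ≤ (D.vset \ C.vset).card) := by
  obtain ⟨D, l, k, k', r, i₀, i₁, i₂, hC, hD, he, hrk', hout, h12, hi1, hi2, hdeg1, hdeg2⟩ :=
    hC.exists_second hc hd hy
  have hthird : ∀ x, x = k ∨ x = k' ∨ x = r := by
    have h1 := hC.ne
    have h2 := hD.ne
    have : ∀ k k' r : Fin 3, k ≠ k' → k ≠ r → r ≠ k' → ∀ x, x = k ∨ x = k' ∨ x = r := by decide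
    exact this k k' r h1 h2 hrk'
  refine ⟨D, l, k, r, hD, he, ?_, ?_⟩
  · set T := C.degTwo.erase i₀ with hT
    have hTcard : C.degTwo.card ≤ T.card + 1 := by
      have := Finset.pred_card_le_card_erase (s := C.degTwo) (a := i₀)
      rw [hT]; omega
    have hTmem : ∀ i ∈ T, G.degree (C.z i) ≤ 2 ∧ C.z i ∉ D.verts := by
      intro i hi
      rw [hT, Finset.mem_erase, OddCycle.degTwo, Finset.mem_filter] at hi
      exact ⟨hi.2.2, hout i hi.2.2 hi.1⟩
    have hjD : C.z j ∈ D.verts ∧ C.z (j + 1) ∈ D.verts := by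
      rcases D.eq_of_edge_eq he.symm with ⟨h1, h2⟩ | ⟨h1, h2⟩ <;> rw [h1, h2] <;>
        exact ⟨D.z_mem _, D.z_mem _⟩
    -- The partner along the common colour `k` is not on `D` either.
    have hpart : ∀ i ∈ T, ∃ i', c s(C.z i, C.z i') = some k ∧ G.Adj (C.z i) (C.z i') ∧
        G.degree (C.z i') = 3 ∧ C.z i' ∉ D.verts := by
      intro i hi
      obtain ⟨hi2, hiD⟩ := hTmem i hi
      have key : ∀ i', c s(C.z i, C.z i') = some k → G.Adj (C.z i) (C.z i') →
          C.z i' ∉ D.verts := by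
        intro i' h1 h2 h3
        exact hiD (hD.mem_of_color h3 h2.symm (Or.inl (by rw [Sym2.eq_swap, h1])))
      have hij : i ≠ j := fun h => hiD (h ▸ hjD.1)
      have hij' : i ≠ j + 1 := fun h => hiD (h ▸ hjD.2)
      rcases hC.colors_at hc.1 hij hij' with h | h
      · exact ⟨i + 1, h.1, C.adj i, hC.degree_succ hc hd hi2, key _ h.1 (C.adj i)⟩
      · have h2 := h.2
        rw [C.edge_sub_one] at h2
        exact ⟨i - 1, h2, C.adj_sub i, hC.degree_pred hc hd hi2, key _ h2 (C.adj_sub i)⟩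
    choose! π hπ using hpart
    have hπinj : Set.InjOn π T := by
      intro i hi i' hi' h
      obtain ⟨a1, a2, -, -⟩ := hπ i hi
      obtain ⟨b1, b2, -, -⟩ := hπ i' hi'
      rw [← h] at b1 b2
      rw [Sym2.eq_swap] at a1 b1
      exact C.inj (hc.1 a2.symm b2.symm a1 b1)
    have hdisj : Disjoint T (T.image π) := by
      rw [Finset.disjoint_left]
      intro i hi hi'
      obtain ⟨m, hm, rfl⟩ := Finset.mem_image.1 hi'
      have h1 := (hTmem _ hi).1
      have h2 := (hπ _ hm).2.2.1
      omega
    have hsub : (T ∪ T.image π).image C.z ⊆ C.vset \ D.vset := by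
      intro v hv
      obtain ⟨i, hi, rfl⟩ := Finset.mem_image.1 hv
      rw [Finset.mem_sdiff, C.mem_vset, D.mem_vset]
      refine ⟨C.z_mem i, ?_⟩
      rcases Finset.mem_union.1 hi with hi | hi
      · exact (hTmem _ hi).2
      · obtain ⟨i', hi', rfl⟩ := Finset.mem_image.1 hi
        exact (hπ _ hi').2.2.2
    have hcard := Finset.card_le_card hsub
    rw [Finset.card_image_of_injective _ C.inj, Finset.card_union_of_disjoint hdisj,
      Finset.card_image_of_injOn hπinj] at hcard
    have e1 := Finset.card_sdiff_add_card_inter C.vset D.vset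
    have e2 := Finset.card_sdiff_add_card_inter D.vset C.vset
    rw [Finset.inter_comm] at e2
    rw [C.card_vset] at e1
    rw [D.card_vset] at e2
    omega
  · -- Two vertices of degree three on both cycles; there `D` leaves `C`, which has no chords.
    intro hg
    have hex : ∀ i, C.z i ∈ D.verts → G.degree (C.z i) = 3 →
        ∃ u, G.Adj (C.z i) u ∧ c s(C.z i, u) = some r ∧ u ∈ D.vset \ C.vset := by
      intro i hi h3
      obtain ⟨u, hu, hu1, hu2⟩ := C.exists_stub h3
      have hcol := hC.stub_color hc hd hthird hu hu1 hu2
      refine ⟨u, hu, hcol, ?_⟩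
      rw [Finset.mem_sdiff, C.mem_vset, D.mem_vset]
      exact ⟨hD.mem_of_color hi hu (Or.inr hcol), OddCycle.stub_notMem hg hu hu1 hu2⟩
    obtain ⟨u, hu, hcu, hu'⟩ := hex i₁ hi1 hdeg1
    obtain ⟨w, hw, hcw, hw'⟩ := hex i₂ hi2 hdeg2
    have huw : u ≠ w := by
      rintro rfl
      rw [Sym2.eq_swap] at hcu hcw
      exact h12 (C.inj (hc.1 hu.symm hw.symm hcu hcw))
    have : ({u, w} : Finset V) ⊆ D.vset \ C.vset := by
      intro x hx
      simp only [Finset.mem_insert, Finset.mem_singleton] at hx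
      rcases hx with rfl | rfl <;> assumption
    rw [← Finset.card_pair huw]
    exact Finset.card_le_card this

end Alternating

end ThreeColoring

/-! ### Recognising the Petersen graph -/

namespace ThreeColoring

open Function

section Petersen

/-- Adjacency in the usual drawing of the Petersen graph: an outer pentagon `inl`, an inner
pentagram `inr`, and a spoke for every index. -/
def PentagonAdj : ZMod 5 ⊕ ZMod 5 → ZMod 5 ⊕ ZMod 5 → Prop
  | .inl i, .inl k => k = i + 1 ∨ k = i - 1
  | .inl i, .inr k => k = i
  | .inr i, .inl k => k = i
  | .inr i, .inr k => k = i + 2 ∨ k = i - 2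

instance : DecidableRel PentagonAdj := fun x y => by
  rcases x with i | i <;> rcases y with k | k <;> unfold PentagonAdj <;> infer_instance

/-- The drawing of the Petersen graph in terms of pairs of elements of `Fin 5`. -/
def pentagonPair : ZMod 5 ⊕ ZMod 5 → {s : Finset (Fin 5) // s.card = 2}
  | .inl i => ⟨({2 * i, 2 * i + 1} : Finset (ZMod 5)), by revert i; decide⟩
  | .inr i => ⟨({2 * i + 2, 2 * i + 4} : Finset (ZMod 5)), by revert i; decide⟩

lemma pentagonPair_bijective : Bijective pentagonPair := by
  rw [Fintype.bijective_iff_injective_and_card]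
  refine ⟨by decide, by rw [Fintype.card_finset_len]; rfl⟩

lemma petersenGraph_adj_iff (x y : ZMod 5 ⊕ ZMod 5) :
    petersenGraph.Adj (pentagonPair x) (pentagonPair y) ↔ PentagonAdj x y := by
  change Disjoint (pentagonPair x).1 (pentagonPair y).1 ↔ _
  revert x y
  decide

variable {V : Type*} [Fintype V] [DecidableEq V] {G : SimpleGraph V} [DecidableRel G.Adj]

lemma mem_of_closed (hG : G.Connected) {S : Set V} (hne : S.Nonempty)
    (hS : ∀ v w, v ∈ S → G.Adj v w → w ∈ S) (v : V) : v ∈ S := by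
  obtain ⟨u, hu⟩ := hne
  obtain ⟨w⟩ := hG.preconnected u v
  induction w with
  | nil => exact hu
  | cons h _ ih => exact ih (hS _ _ hu h)

/-- A connected subcubic graph is the Petersen graph if it contains two disjoint pentagons joined
by a matching of five edges under which adjacent vertices correspond to non-adjacent ones. -/
lemma nonempty_iso_petersenGraph (hG : G.Connected) (hd : ∀ v, G.degree v ≤ 3)
    {a b : ZMod 5 → V} {κ : ZMod 5 → ZMod 5} (ha : Injective a) (hb : Injective b)
    (hab : ∀ i k, a i ≠ b k) (haa : ∀ i, G.Adj (a i) (a (i + 1)))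
    (hbb : ∀ i, G.Adj (b i) (b (i + 1))) (hκ : ∀ i, G.Adj (a i) (b (κ i)))
    (hstep : ∀ i, κ (i + 1) ≠ κ i ∧ κ (i + 1) ≠ κ i + 1 ∧ κ (i + 1) ≠ κ i - 1) :
    Nonempty (G ≃g petersenGraph) := by
  have hbb' : ∀ i, G.Adj (b i) (b (i - 1)) := fun i => by
    have := hbb (i - 1)
    rw [sub_add_cancel] at this
    exact this.symm
  have haa' : ∀ i, G.Adj (a i) (a (i - 1)) := fun i => by
    have := haa (i - 1)
    rw [sub_add_cancel] at this
    exact this.symm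
  have hpm : ∀ i : ZMod 5, i + 1 ≠ i - 1 := by decide
  have hpm2 : ∀ i : ZMod 5, i + 2 ≠ i - 2 := by decide
  have hne2 : ∀ i : ZMod 5, i + 2 ≠ i := by decide
  have hκinj : Injective κ := by
    intro i k h
    have h1 := (hκ i).symm
    have h2 := (hκ k).symm
    rw [← h] at h2
    rcases eq_or_eq_or_eq_of_degree_le (hd _) h1 (hbb _) (hbb' _) (hab _ _) (hab _ _)
      (hb.ne (hpm _)) h2 with h3 | h3 | h3
    · exact (ha h3).symm
    · exact absurd h3 (hab _ _)
    · exact absurd h3 (hab _ _)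
  have htwo : ∀ i, κ (i + 2) = κ i + 1 ∨ κ (i + 2) = κ i - 1 := by
    intro i
    have h1 := hstep i
    have h2 := hstep (i + 1)
    have e : i + 1 + 1 = i + 2 := by ring
    rw [e] at h2
    have h3 : κ (i + 2) ≠ κ i := hκinj.ne (hne2 i)
    revert h1 h2 h3
    generalize κ i = x
    generalize κ (i + 1) = y
    generalize κ (i + 2) = z
    revert x y z
    decide
  set f : ZMod 5 ⊕ ZMod 5 → V := Sum.elim a (b ∘ κ) with hf
  have hfinj : Injective f := by
    rintro (i | i) (k | k) h
    · rw [ha h]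
    · exact absurd h (hab _ _)
    · exact absurd h.symm (hab _ _)
    · rw [hκinj (hb h)]
  have hbtwo : ∀ i, G.Adj (b (κ i)) (b (κ (i + 2))) := by
    intro i
    rcases htwo i with h | h <;> rw [h]
    · exact hbb _
    · exact hbb' _
  have hnbr : ∀ x, ∃ y₁ y₂ y₃, PentagonAdj x y₁ ∧ PentagonAdj x y₂ ∧ PentagonAdj x y₃ ∧
      ∀ w, G.Adj (f x) w ↔ w = f y₁ ∨ w = f y₂ ∨ w = f y₃ := by
    rintro (i | i)
    · refine ⟨.inl (i + 1), .inl (i - 1), .inr i, Or.inl rfl, Or.inr rfl, rfl, fun w => ⟨fun hw =>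
        eq_or_eq_or_eq_of_degree_le (hd _) (haa i) (haa' i) (hκ i) (ha.ne (hpm i)) (hab _ _)
          (hab _ _) hw, ?_⟩⟩
      rintro (rfl | rfl | rfl)
      exacts [haa i, haa' i, hκ i]
    · have h2 := hbtwo (i - 2)
      rw [sub_add_cancel] at h2
      refine ⟨.inr (i + 2), .inr (i - 2), .inl i, Or.inl rfl, Or.inr rfl, rfl, fun w => ⟨fun hw =>
        eq_or_eq_or_eq_of_degree_le (hd _) (hbtwo i) h2.symm (hκ i).symm
          (hb.ne (hκinj.ne (hpm2 i))) (hab _ _).symm (hab _ _).symm hw, ?_⟩⟩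
      rintro (rfl | rfl | rfl)
      exacts [hbtwo i, h2.symm, (hκ i).symm]
  have hfsurj : Surjective f := by
    intro v
    refine mem_of_closed hG (S := Set.range f) ⟨f (.inl 0), _, rfl⟩ ?_ v
    rintro _ w ⟨x, rfl⟩ hw
    obtain ⟨y₁, y₂, y₃, -, -, -, h⟩ := hnbr x
    rcases (h w).1 hw with rfl | rfl | rfl <;> exact ⟨_, rfl⟩
  have hfadj : ∀ x y, G.Adj (f x) (f y) ↔ PentagonAdj x y := by
    intro x y
    constructor
    · intro h
      obtain ⟨y₁, y₂, y₃, h1, h2, h3, hall⟩ := hnbr x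
      rcases (hall _).1 h with h' | h' | h' <;> rw [hfinj h'] <;> assumption
    · rcases x with i | i <;> rcases y with k | k
      · rintro (rfl | rfl)
        exacts [haa i, haa' i]
      · rintro rfl; exact hκ _
      · rintro rfl; exact (hκ _).symm
      · rintro (rfl | rfl)
        · exact hbtwo i
        · have h2 := hbtwo (i - 2)
          rw [sub_add_cancel] at h2
          exact h2.symm
  let ef := Equiv.ofBijective f ⟨hfinj, hfsurj⟩
  let ep := Equiv.ofBijective pentagonPair pentagonPair_bijective
  refine ⟨⟨ef.symm.trans ep, ?_⟩⟩
  intro v w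
  obtain ⟨x, rfl⟩ := hfsurj v
  obtain ⟨y, rfl⟩ := hfsurj w
  have e : ∀ x, ef.symm (f x) = x := fun x => ef.symm_apply_apply x
  rw [Equiv.trans_apply, Equiv.trans_apply, e, e, hfadj]
  exact petersenGraph_adj_iff x y

lemma nonempty_iso_of_pentagons (hG : G.Connected) (hd : ∀ v, G.degree v ≤ 3) {C D : OddCycle G}
    (hC : C.L = 5) (hD : D.L = 5) (hCD : ∀ i k, C.z i ≠ D.z k) {κ : ZMod C.L → ZMod D.L}
    (hκ : ∀ i, G.Adj (C.z i) (D.z (κ i)))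
    (hstep : ∀ i, κ (i + 1) ≠ κ i ∧ κ (i + 1) ≠ κ i + 1 ∧ κ (i + 1) ≠ κ i - 1) :
    Nonempty (G ≃g petersenGraph) := by
  obtain ⟨L, a, _, _, ha, haa⟩ := C
  obtain ⟨M, b, _, _, hb, hbb⟩ := D
  change L = 5 at hC
  change M = 5 at hD
  subst hC hD
  exact nonempty_iso_petersenGraph hG hd ha hb hCD haa hbb hκ hstep

end Petersen

end ThreeColoring

/-! ### Systems of alternating cycles and tight cycles -/

namespace ThreeColoring

variable {V : Type*} [Fintype V] [DecidableEq V] {G : SimpleGraph V} [DecidableRel G.Adj]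
  {c : Sym2 V → Option (Fin 3)}

/-- A choice of a longest alternating cycle `cyc e` for every uncoloured edge `e`, which is its
`base e`-th edge; the other edges have the colours `p e` and `q e`. -/
structure CycleSystem (G : SimpleGraph V) [DecidableRel G.Adj]
    (c : Sym2 V → Option (Fin 3)) where
  cyc : {e // e ∈ uncolored G c} → OddCycle G
  base : ∀ e, ZMod (cyc e).L
  p : {e // e ∈ uncolored G c} → Fin 3
  q : {e // e ∈ uncolored G c} → Fin 3
  alt : ∀ e, Alternating c (cyc e) (base e) (p e) (q e)
  edge_eq : ∀ e, (cyc e).edge (base e) = e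
  len : ∀ e, (cyc e).L = cycleLen G c e

lemma IsOptimal.nonempty_cycleSystem (hc : IsOptimal G c) (hd : ∀ v, G.degree v ≤ 3) :
    Nonempty (CycleSystem G c) := by
  choose C j p q h1 h2 h3 using
    fun e : {e // e ∈ uncolored G c} => hc.exists_longest hd e.2
  exact ⟨⟨C, j, p, q, h1, h2, h3⟩⟩

namespace CycleSystem

variable (S : CycleSystem G c) {e f : {e // e ∈ uncolored G c}}

lemma edge_ne (h : e ≠ f) : (S.cyc e).edge (S.base e) ≠ (S.cyc f).edge (S.base f) := by
  rw [S.edge_eq, S.edge_eq]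
  exact fun h' => h (Subtype.ext h')

lemma length_eq (e) : (S.cyc e).L = cycleLen G c ((S.cyc e).edge (S.base e)) := by
  rw [S.edge_eq, S.len]

lemma disjoint (hc : IsOptimal G c) (hd : ∀ v, G.degree v ≤ 3) (h : e ≠ f) {v : V}
    (hv : v ∈ (S.cyc e).verts) : v ∉ (S.cyc f).verts :=
  (S.alt e).disjoint (S.alt f) hc hd (S.edge_ne h) hv

/-- The `i`-th vertex of the cycle of `e` has a neighbour on the cycle of `f`. -/
def Joined (e : {e // e ∈ uncolored G c}) (i : ZMod (S.cyc e).L)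
    (f : {e // e ∈ uncolored G c}) : Prop :=
  ∃ k, G.Adj ((S.cyc e).z i) ((S.cyc f).z k)

variable {S}

/-- A joined vertex has only one neighbour outside its own cycle. -/
lemma Joined.eq (hc : IsOptimal G c) (hd : ∀ v, G.degree v ≤ 3) {i : ZMod (S.cyc e).L}
    {k : ZMod (S.cyc f).L} {w : V} (hef : e ≠ f) (hw : w ∉ (S.cyc e).verts)
    (h : G.Adj ((S.cyc e).z i) ((S.cyc f).z k)) (h' : G.Adj ((S.cyc e).z i) w) :
    w = (S.cyc f).z k := by
  have hk : ∀ m, (S.cyc f).z k ≠ (S.cyc e).z m := fun m h =>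
    S.disjoint hc hd hef ((S.cyc e).z_mem m) (h ▸ (S.cyc f).z_mem k)
  rcases eq_or_eq_or_eq_of_degree_le (hd _) h ((S.cyc e).adj i) ((S.cyc e).adj_sub i) (hk _) (hk _)
    ((S.cyc e).z_succ_ne_pred i) h' with h | h | h
  · exact h
  · exact absurd (h ▸ (S.cyc e).z_mem _) hw
  · exact absurd (h ▸ (S.cyc e).z_mem _) hw

lemma Joined.degree (hc : IsOptimal G c) (hd : ∀ v, G.degree v ≤ 3) {i : ZMod (S.cyc e).L}
    (hef : e ≠ f) (h : S.Joined e i f) :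
    G.degree ((S.cyc e).z i) = 3 ∧ G.degree ((S.cyc e).z (i + 1)) = 3 ∧
      G.degree ((S.cyc e).z (i - 1)) = 3 := by
  obtain ⟨k, hk⟩ := h
  have hk' : ∀ m, (S.cyc f).z k ≠ (S.cyc e).z m := fun m h =>
    S.disjoint hc hd hef ((S.cyc e).z_mem m) (h ▸ (S.cyc f).z_mem k)
  exact ⟨(S.cyc e).degree_eq_three hd hk (hk' _) (hk' _),
    ((S.alt e).next_to_edge (S.alt f) hc hd (S.edge_ne hef) hk).1⟩

/-- Consecutive vertices of a cycle cannot be joined to different other cycles. -/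
lemma Joined.succ_eq (hc : IsOptimal G c) (hd : ∀ v, G.degree v ≤ 3) {i : ZMod (S.cyc e).L}
    {f' : {e // e ∈ uncolored G c}} (hef : e ≠ f) (hef' : e ≠ f') (h : S.Joined e i f)
    (h' : S.Joined e (i + 1) f') : f' = f := by
  by_contra hne
  obtain ⟨k, hk⟩ := h
  obtain ⟨k', hk'⟩ := h'
  have hw : (S.cyc f').z k' ∉ (S.cyc e).verts :=
    S.disjoint hc hd hef'.symm ((S.cyc f').z_mem k')
  exact (((S.alt e).next_to_edge (S.alt f) hc hd (S.edge_ne hef) hk).2 _ hw (Or.inl hk')).2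
    (S.cyc f') _ _ _ (S.alt f') (S.edge_ne hef'.symm) (S.edge_ne hne) ((S.cyc f').z_mem k')

/-- If consecutive vertices of a cycle are joined to the same other cycle, then at vertices that are
neither equal nor adjacent on it. -/
lemma Joined.steps (hc : IsOptimal G c) (hd : ∀ v, G.degree v ≤ 3) {i : ZMod (S.cyc e).L}
    {k k' : ZMod (S.cyc f).L} (hef : e ≠ f) (h : G.Adj ((S.cyc e).z i) ((S.cyc f).z k))
    (h' : G.Adj ((S.cyc e).z (i + 1)) ((S.cyc f).z k')) : k' ≠ k ∧ k' ≠ k + 1 ∧ k' ≠ k - 1 := by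
  have hw : (S.cyc f).z k' ∉ (S.cyc e).verts :=
    S.disjoint hc hd hef.symm ((S.cyc f).z_mem k')
  have := (((S.alt e).next_to_edge (S.alt f) hc hd (S.edge_ne hef) h).2 _ hw (Or.inl h')).1
  exact ⟨fun h => this.1 (by rw [h]), fun h => this.2.1 (by rw [h]), fun h => this.2.2 (by rw [h])⟩

variable (S)

/-- A cycle of the system is tight if it has length `g`, contains no vertex of degree less than
three, and is joined to other cycles of the system at all its vertices except for at most one,
which is `i₀`. -/
structure Tight (g : ℕ) (e : {e // e ∈ uncolored G c}) (i₀ : ZMod (S.cyc e).L) : Prop where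
  len : (S.cyc e).L = g
  degree : ∀ i, G.degree ((S.cyc e).z i) = 3
  joined : ∀ i, i ≠ i₀ → ∃ f, e ≠ f ∧ S.Joined e i f

variable {S}

/-- A tight cycle is joined to only one other cycle. -/
lemma Tight.exists_partner {g : ℕ} {i₀ : ZMod (S.cyc e).L} (h : S.Tight g e i₀)
    (hc : IsOptimal G c) (hd : ∀ v, G.degree v ≤ 3) :
    ∃ f, e ≠ f ∧ ∀ i, i ≠ i₀ → S.Joined e i f := by
  have hL := (S.cyc e).three_le
  have h1 : i₀ + 1 ≠ i₀ := (S.cyc e).add_one_ne i₀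
  obtain ⟨f, hef, hf⟩ := h.joined _ h1
  have key : ∀ n : ℕ, n + 1 < (S.cyc e).L → S.Joined e (i₀ + 1 + n) f := by
    intro n
    induction n with
    | zero => intro _; simpa using hf
    | succ n ih =>
      intro hn
      have ih := ih (by omega)
      have hne : i₀ + 1 + ((n + 1 : ℕ) : ZMod (S.cyc e).L) ≠ i₀ := by
        intro h
        refine zmod_natCast_ne_zero (L := (S.cyc e).L) (n := n + 2) (by omega) (by omega) ?_
        push_cast at h ⊢
        linear_combination h
      obtain ⟨f', hef', hf'⟩ := h.joined _ hne
      have e1 : i₀ + 1 + ((n + 1 : ℕ) : ZMod (S.cyc e).L) = i₀ + 1 + n + 1 := by push_cast; ring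
      rw [e1] at hf' ⊢
      rwa [← ih.succ_eq hc hd hef hef' hf']
  refine ⟨f, hef, fun i hi => ?_⟩
  have hv : (i - i₀ - 1).val + 1 < (S.cyc e).L := by
    have hlt := ZMod.val_lt (i - i₀ - 1)
    by_contra hcon
    have : (((i - i₀ - 1).val + 1 : ℕ) : ZMod (S.cyc e).L) = 0 := by
      have : (i - i₀ - 1).val + 1 = (S.cyc e).L := by omega
      rw [this, ZMod.natCast_self]
    rw [Nat.cast_add, ZMod.natCast_val, ZMod.cast_id] at this
    apply hi
    push_cast at this
    linear_combination this
  have := key _ hv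
  rw [ZMod.natCast_val, ZMod.cast_id] at this
  have e1 : i₀ + 1 + (i - i₀ - 1) = i := by ring
  rwa [e1] at this

/-- In an extremal colouring, a tight cycle whose partner is a shortest odd cycle, too, forms the
Petersen graph together with it. -/
lemma Tight.petersen {g : ℕ} {i₀ : ZMod (S.cyc e).L} (h : S.Tight g e i₀)
    (hG : G.Connected) (hc : IsExtremal G c) (hd : ∀ v, G.degree v ≤ 3) (hg : OddWalksGE G g)
    (hef : e ≠ f) (hf : ∀ i, i ≠ i₀ → S.Joined e i f) (hlen : (S.cyc f).L = g) :
    Nonempty (G ≃g petersenGraph) := by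
  have hdisj : ∀ i k, (S.cyc e).z i ≠ (S.cyc f).z k := fun i k h =>
    S.disjoint hc.1 hd hef ((S.cyc e).z_mem i) (h ▸ (S.cyc f).z_mem k)
  have hgf : OddWalksGE G (S.cyc f).L := by rwa [hlen]
  have hL := (S.cyc e).three_le
  have n1 : i₀ + 1 ≠ i₀ := (S.cyc e).add_one_ne i₀
  have n2 : i₀ + 1 + 1 ≠ i₀ := fun h => zmod_two_ne_zero hL (by linear_combination h)
  obtain ⟨k1, hk1⟩ := hf _ n1
  obtain ⟨k2, hk2⟩ := hf _ n2
  have s12 := Joined.steps hc.1 hd hef hk1 hk2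
  -- The partners of three consecutive vertices force the length five.
  have hL3 : (S.cyc e).L ≠ 3 := by
    intro h3
    have h3' : (S.cyc f).L = 3 := by rw [hlen, ← h.len, h3]
    have : ((3 : ℕ) : ZMod (S.cyc f).L) = 0 := by rw [← h3']; exact ZMod.natCast_self _
    push_cast at this
    rcases OddCycle.three_apart hgf hk1 hk2 ((S.cyc e).adj _) s12.1 s12.2.1 s12.2.2 with h | h <;>
      rw [this] at h <;> simp at h <;> exact s12.1 h
  have n3 : i₀ + 1 + 1 + 1 ≠ i₀ := by
    intro h
    refine zmod_natCast_ne_zero (L := (S.cyc e).L) (n := 3) (by omega) (by omega) ?_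
    push_cast
    linear_combination h
  obtain ⟨k3, hk3⟩ := hf _ n3
  have s23 := Joined.steps hc.1 hd hef hk2 hk3
  have k13 : k3 ≠ k1 := by
    rintro rfl
    have := Joined.eq hc.1 hd hef.symm (S.disjoint hc.1 hd hef ((S.cyc e).z_mem (i₀ + 1 + 1 + 1)))
      hk1.symm hk3.symm
    have := (S.cyc e).inj this
    exact zmod_two_ne_zero hL (by linear_combination this)
  have hf5 : (S.cyc f).L = 5 := OddCycle.length_eq_five hgf hk1 hk2 hk3 ((S.cyc e).adj _)
    ((S.cyc e).adj _) s12.1 s12.2.1 s12.2.2 s23.1 s23.2.1 s23.2.2 k13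
  have he5 : (S.cyc e).L = 5 := by rw [h.len, ← hlen, hf5]
  have hg5 : OddWalksGE G 5 := by rwa [← hf5]
  -- By extremality the exceptional vertex is joined to the partner cycle as well.
  have hi₀ : S.Joined e i₀ f := by
    obtain ⟨w, hw, hw1, hw2⟩ := (S.cyc e).exists_stub (h.degree i₀)
    have hge : OddWalksGE G (S.cyc e).L := by rwa [he5]
    have hwe : w ∉ (S.cyc e).verts := OddCycle.stub_notMem hge hw hw1 hw2
    have hwf : w ∈ (S.cyc f).verts := by
      refine hc.mem_of_pentagons hd hg5 (S.alt e) (S.alt f) (S.length_eq e) (S.length_eq f) (S.edge_ne hef)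
        he5 hf5 hk1 hk2 ?_ hwe
      rwa [add_sub_cancel_right]
    obtain ⟨k, rfl⟩ := hwf
    exact ⟨k, hw⟩
  have hall : ∀ i, S.Joined e i f := fun i => by
    by_cases hi : i = i₀
    · rwa [hi]
    · exact hf i hi
  choose κ hκ using hall
  have hsteps : ∀ i, κ (i + 1) ≠ κ i ∧ κ (i + 1) ≠ κ i + 1 ∧ κ (i + 1) ≠ κ i - 1 := fun i =>
    Joined.steps hc.1 hd hef (hκ i) (hκ (i + 1))
  exact nonempty_iso_of_pentagons hG hd he5 hf5 hdisj hκ hsteps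

end CycleSystem

end ThreeColoring

/-! ### Discharging -/

namespace ThreeColoring

variable {V : Type*} [Fintype V] [DecidableEq V] {G : SimpleGraph V} [DecidableRel G.Adj]
  {c : Sym2 V → Option (Fin 3)}

/-- The pairs `(v, w)` of adjacent vertices with `v` outside `W` and `w` in `X`. -/
def entering (G : SimpleGraph V) [DecidableRel G.Adj] (W X : Finset V) : Finset (V × V) :=
  Finset.univ.filter fun x => x.1 ∉ W ∧ G.Adj x.1 x.2 ∧ x.2 ∈ X

lemma mem_entering {W X : Finset V} {v w : V} :
    (v, w) ∈ entering G W X ↔ v ∉ W ∧ G.Adj v w ∧ w ∈ X := by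
  simp [entering]

/-- The degree sum is at least what disjoint sets `Z e` contribute themselves and what is
contributed by the edges that enter disjoint sets `X e` from outside of all sets `Z e`. -/
lemma sum_le_two_mul_card_edges {ι : Type*} [Fintype ι] (Z X : ι → Finset V)
    (hZ : ∀ e f, e ≠ f → Disjoint (Z e) (Z f)) (hX : ∀ e f, e ≠ f → Disjoint (X e) (X f)) :
    ∑ e, (∑ v ∈ Z e, G.degree v + (entering G (Finset.univ.biUnion Z) (X e)).card) ≤
      2 * G.edgeFinset.card := by
  classical
  set W := Finset.univ.biUnion Z with hW
  rw [Finset.sum_add_distrib, ← G.sum_degrees_eq_twice_card_edges]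
  have h1 : ∑ e, ∑ v ∈ Z e, G.degree v = ∑ v ∈ W, G.degree v :=
    (Finset.sum_biUnion fun e _ f _ h => hZ e f h).symm
  have h2 : ∑ e, (entering G W (X e)).card ≤ ∑ v ∈ Wᶜ, G.degree v := by
    have hsub : Finset.univ.biUnion (fun e => entering G W (X e)) ⊆
        Finset.univ.filter fun x : V × V => x.1 ∈ Wᶜ ∧ G.Adj x.1 x.2 := by
      rintro ⟨v, w⟩ h
      rw [Finset.mem_biUnion] at h
      obtain ⟨e, -, he⟩ := h
      rw [mem_entering] at he
      simp [he.1, he.2.1]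
    have hcard := Finset.card_le_card hsub
    rw [Finset.card_biUnion] at hcard
    · refine hcard.trans (le_of_eq ?_)
      rw [Finset.card_eq_sum_card_fiberwise (f := Prod.fst) (t := Wᶜ)]
      · refine Finset.sum_congr rfl fun v hv => ?_
        rw [← G.card_neighborFinset_eq_degree]
        refine Finset.card_bij' (fun x _ => x.2) (fun w _ => (v, w)) ?_ ?_ ?_ ?_
        · rintro ⟨a, b⟩ h
          simp only [Finset.mem_filter, Finset.mem_univ, true_and] at h
          obtain ⟨⟨-, h⟩, rfl⟩ := h
          simpa using h
        · intro w hw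
          rw [SimpleGraph.mem_neighborFinset] at hw
          simp only [Finset.mem_filter, Finset.mem_univ, true_and]
          exact ⟨⟨hv, hw⟩, trivial⟩
        · rintro ⟨a, b⟩ h
          simp only [Finset.mem_filter, Finset.mem_univ, true_and] at h
          rw [h.2]
        · intro w _; rfl
      · rintro ⟨a, b⟩ h
        simp only [Finset.coe_filter, Finset.mem_univ, true_and, Set.mem_ofPred_eq] at h
        exact h.1
    · intro e _ f _ hef
      refine Finset.disjoint_left.2 ?_
      rintro ⟨v, w⟩ h h'
      rw [mem_entering] at h h'
      exact Finset.disjoint_left.1 (hX e f hef) h.2.2 h'.2.2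
  rw [h1, ← Finset.sum_add_sum_compl W]
  omega

namespace OddCycle

lemma sum_degree (C : OddCycle G) (hd : ∀ v, G.degree v ≤ 3) :
    ∑ v ∈ C.vset, G.degree v + C.degTwo.card = 3 * C.L := by
  rw [vset, Finset.sum_image fun i _ k _ h => C.inj h, degTwo, Finset.card_filter,
    ← Finset.sum_add_distrib]
  have : ∀ i ∈ (Finset.univ : Finset (ZMod C.L)),
      (G.degree (C.z i) + if G.degree (C.z i) ≤ 2 then 1 else 0) = 3 := by
    intro i _
    have h1 := hd (C.z i)
    have h2 := C.two_le_degree i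
    split_ifs <;> omega
  rw [Finset.sum_congr rfl this, Finset.sum_const, Finset.card_univ, ZMod.card, smul_eq_mul,
    mul_comm]

/-- Every vertex of a cycle outside of `W` has two neighbours on the cycle. -/
lemma two_mul_le_card_entering (C : OddCycle G) {W U : Finset V} (hU : U ⊆ C.vset)
    (hUW : ∀ v ∈ U, v ∉ W) : 2 * U.card ≤ (entering G W C.vset).card := by
  set I : Finset (ZMod C.L) := Finset.univ.filter fun i => C.z i ∈ U with hI
  have hIU : I.image C.z = U := by
    ext v
    rw [Finset.mem_image]
    constructor
    · rintro ⟨i, hi, rfl⟩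
      rw [hI, Finset.mem_filter] at hi
      exact hi.2
    · intro hv
      obtain ⟨i, rfl⟩ := C.mem_vset.1 (hU hv)
      exact ⟨i, by rw [hI, Finset.mem_filter]; exact ⟨Finset.mem_univ _, hv⟩, rfl⟩
  have hcard : I.card = U.card := by
    rw [← hIU, Finset.card_image_of_injective _ C.inj]
  have hsub : I.image (fun i => (C.z i, C.z (i + 1))) ∪ I.image (fun i => (C.z i, C.z (i - 1))) ⊆
      entering G W C.vset := by
    intro x hx
    rw [Finset.mem_union, Finset.mem_image, Finset.mem_image] at hx
    rcases hx with ⟨i, hi, rfl⟩ | ⟨i, hi, rfl⟩ <;> rw [hI, Finset.mem_filter] at hi <;>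
      rw [mem_entering, C.mem_vset]
    · exact ⟨hUW _ hi.2, C.adj i, C.z_mem _⟩
    · exact ⟨hUW _ hi.2, C.adj_sub i, C.z_mem _⟩
  have hdisj : Disjoint (I.image fun i => (C.z i, C.z (i + 1)))
      (I.image fun i => (C.z i, C.z (i - 1))) := by
    rw [Finset.disjoint_left]
    rintro x hx hx'
    obtain ⟨i, -, rfl⟩ := Finset.mem_image.1 hx
    obtain ⟨k, -, hk⟩ := Finset.mem_image.1 hx'
    rw [Prod.mk.injEq] at hk
    rw [C.inj hk.1] at hk
    exact C.z_succ_ne_pred i hk.2.symm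
  have := Finset.card_le_card hsub
  rw [Finset.card_union_of_disjoint hdisj,
    Finset.card_image_of_injective _ (fun i k h => C.inj (Prod.mk.inj h).1),
    Finset.card_image_of_injective _ (fun i k h => C.inj (Prod.mk.inj h).1), hcard] at this
  omega

lemma card_le_card_entering (C : OddCycle G) {W : Finset V} {I : Finset (ZMod C.L)}
    (hI : ∀ i ∈ I, ∃ w, w ∉ W ∧ G.Adj (C.z i) w) :
    I.card ≤ (entering G W C.vset).card := by
  have : Nonempty V := ⟨C.z 0⟩
  choose! w hw using hI
  refine Finset.card_le_card_of_injOn (fun i => (w i, C.z i)) ?_ ?_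
  · intro i hi
    rw [Finset.mem_coe, mem_entering, C.mem_vset]
    exact ⟨(hw i hi).1, (hw i hi).2.symm, C.z_mem i⟩
  · intro i _ k _ h
    exact C.inj (Prod.mk.inj h).2

end OddCycle

namespace CycleSystem

variable {S : CycleSystem G c} {e f : {e // e ∈ uncolored G c}}

/-- If `K` is a set of tight cycles of length `g` with the same partner `f`, then they meet
disjoint sets of `g - 1` vertices of the cycle of `f`; these sets do not contain vertices of
degree two or successors of such vertices. -/
lemma card_mul_le_length (hc : IsOptimal G c) (hd : ∀ v, G.degree v ≤ 3) {g : ℕ}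
    {K : Finset {e // e ∈ uncolored G c}}
    (hK : ∀ e ∈ K, e ≠ f ∧ ∃ i₀, S.Tight g e i₀ ∧ ∀ i, i ≠ i₀ → S.Joined e i f) :
    K.card * (g - 1) + 2 * (S.cyc f).degTwo.card ≤ (S.cyc f).L := by
  classical
  set lab : {e // e ∈ uncolored G c} → Finset (ZMod (S.cyc f).L) := fun e =>
    Finset.univ.filter fun k => S.Joined f k e with hlab
  have hmem : ∀ e k, k ∈ lab e ↔ S.Joined f k e := fun e k => by simp [hlab]
  have hcard : ∀ e ∈ K, g - 1 ≤ (lab e).card := by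
    intro e he
    obtain ⟨hef, i₀, ht, hj⟩ := hK e he
    choose! κ hκ using hj
    have h1 : (Finset.univ.erase i₀).card = g - 1 := by
      rw [Finset.card_erase_of_mem (Finset.mem_univ _), Finset.card_univ, ZMod.card, ht.len]
    rw [← h1]
    refine Finset.card_le_card_of_injOn κ ?_ ?_
    · intro i hi
      have hi := Finset.ne_of_mem_erase (Finset.mem_coe.1 hi)
      rw [Finset.mem_coe, hmem]
      exact ⟨i, (hκ i hi).symm⟩
    · intro i hi k hk h
      have hi := hκ i (Finset.ne_of_mem_erase (Finset.mem_coe.1 hi))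
      have hk := hκ k (Finset.ne_of_mem_erase (Finset.mem_coe.1 hk))
      rw [← h] at hk
      exact (S.cyc e).inj (Joined.eq hc hd hef.symm
        (S.disjoint hc hd hef ((S.cyc e).z_mem i)) hk.symm hi.symm)
  have hdisj : ∀ e ∈ K, ∀ e' ∈ K, e ≠ e' → Disjoint (lab e) (lab e') := by
    intro e he e' he' hne
    rw [Finset.disjoint_left]
    intro k hk hk'
    rw [hmem] at hk hk'
    obtain ⟨i, hi⟩ := hk
    obtain ⟨i', hi'⟩ := hk'
    have := Joined.eq hc hd (hK e he).1.symm
      (S.disjoint hc hd (hK e' he').1 ((S.cyc e').z_mem i')) hi hi'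
    exact S.disjoint hc hd hne ((S.cyc e).z_mem i) (this ▸ (S.cyc e').z_mem i')
  set T := (S.cyc f).degTwo with hT
  have hTmem : ∀ k, k ∈ T ↔ G.degree ((S.cyc f).z k) ≤ 2 := fun k => by simp [hT, OddCycle.degTwo]
  have hdisj2 : Disjoint T (T.image (· + 1)) := by
    rw [Finset.disjoint_left]
    intro k hk hk'
    obtain ⟨m, hm, rfl⟩ := Finset.mem_image.1 hk'
    rw [hTmem] at hk hm
    have := (S.alt f).degree_succ hc hd hm
    omega
  have hdisj3 : Disjoint (K.biUnion lab) (T ∪ T.image (· + 1)) := by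
    rw [Finset.disjoint_left]
    intro k hk hk'
    obtain ⟨e, he, hke⟩ := Finset.mem_biUnion.1 hk
    rw [hmem] at hke
    have hdeg := hke.degree hc hd (hK e he).1.symm
    rcases Finset.mem_union.1 hk' with h | h
    · rw [hTmem] at h; omega
    · obtain ⟨m, hm, rfl⟩ := Finset.mem_image.1 h
      rw [hTmem] at hm
      rw [add_sub_cancel_right] at hdeg
      omega
  have htotal := Finset.card_le_univ (K.biUnion lab ∪ (T ∪ T.image (· + 1)))
  rw [Finset.card_union_of_disjoint hdisj3, Finset.card_union_of_disjoint hdisj2,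
    Finset.card_biUnion hdisj, Finset.card_image_of_injective _ (add_left_injective 1),
    ZMod.card] at htotal
  have := Finset.card_nsmul_le_sum K (fun e => (lab e).card) (g - 1) hcard
  rw [smul_eq_mul] at this
  omega

end CycleSystem

/-- The arithmetic of the discharging for a cycle of length `L` with `t` vertices of degree two
that is the partner of `k` tight cycles, where `s` is its degree sum, `b` the number of entering
edges, and `m` and `d` are the length of the second alternating cycle and the number of its new
vertices. -/
lemma discharge_long {g L t k s b m d : ℕ} (hg : 3 ≤ g) (hL : g + 2 ≤ L)
    (hk : k * (g - 1) + 2 * t ≤ L) (hs : s + t = 3 * L)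
    (hb : t ≠ 0 → 2 * d ≤ b ∧ g ≤ m ∧ m + 2 * t ≤ L + d + 2) :
    3 * g + 2 + 2 * k ≤ s + b := by
  rcases Nat.lt_or_ge k 3 with h | h
  · have : t = 0 ∨ t ≠ 0 := by omega
    rcases this with h0 | h0
    · interval_cases k <;> omega
    · obtain ⟨h1, h2, h3⟩ := hb h0
      interval_cases k <;> omega
  · obtain ⟨n, rfl⟩ := Nat.exists_eq_add_of_le h
    have h1 : n * 2 ≤ n * (g - 1) := Nat.mul_le_mul_left n (by omega)
    rw [add_mul] at hk
    omega

/-- The main estimate: outside of the Petersen graph, an extremal colouring of a connected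
subcubic graph of odd girth at least `g` leaves at most `2 |E| / (3 g + 2)` edges uncoloured. -/
theorem IsExtremal.card_mul_le (hc : IsExtremal G c) (hG : G.Connected)
    (hd : ∀ v, G.degree v ≤ 3) (hP : IsEmpty (G ≃g petersenGraph)) {g : ℕ}
    (hg : OddWalksGE G g) (hodd : Odd g) (hg3 : 3 ≤ g) :
    (uncolored G c).card * (3 * g + 2) ≤ 2 * G.edgeFinset.card := by
  classical
  obtain ⟨S⟩ := hc.1.nonempty_cycleSystem hd
  have hO := hc.1
  -- The second cycles, which agree with the first ones if these have no vertex of degree two.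
  have hsecond : ∀ e : {e // e ∈ uncolored G c}, ∃ (D : OddCycle G) (l : ZMod D.L) (a b : Fin 3),
      Alternating c D l a b ∧ D.edge l = e ∧ ((S.cyc e).degTwo.card = 0 → D = S.cyc e) ∧ ((S.cyc e).degTwo.card ≠ 0 →
        D.L + 2 * (S.cyc e).degTwo.card ≤
          (S.cyc e).L + (D.vset \ (S.cyc e).vset).card + 2 ∧
        (OddWalksGE G (S.cyc e).L → 2 ≤ (D.vset \ (S.cyc e).vset).card)) := by
    intro e
    by_cases h0 : (S.cyc e).degTwo.card = 0
    · exact ⟨S.cyc e, S.base e, S.p e, S.q e, S.alt e, S.edge_eq e, fun _ => rfl,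
        fun h => absurd h0 h⟩
    · obtain ⟨i, hi⟩ := Finset.card_ne_zero.1 h0
      rw [OddCycle.degTwo, Finset.mem_filter] at hi
      obtain ⟨D, l, a, b, h1, h2, h3⟩ := (S.alt e).exists_second_card hO hd
        (hc.exists_degree_le_two hd (S.alt e) (S.length_eq e) hi.2)
      exact ⟨D, l, a, b, h1, by rw [h2, S.edge_eq], fun h => absurd h h0, fun _ => h3⟩
  choose D l a b hD hDe hD0 hD1 using hsecond
  set Z : {e // e ∈ uncolored G c} → Finset V := fun e => (S.cyc e).vset with hZ
  set X : {e // e ∈ uncolored G c} → Finset V := fun e => (D e).vset with hX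
  set W := Finset.univ.biUnion Z with hW
  have hmemW : ∀ v, v ∈ W ↔ ∃ e, v ∈ (S.cyc e).verts := fun v => by
    simp [hW, hZ, OddCycle.mem_vset]
  have hZdisj : ∀ e f, e ≠ f → Disjoint (Z e) (Z f) := by
    intro e f hef
    rw [Finset.disjoint_left]
    intro v hv hv'
    rw [hZ, OddCycle.mem_vset] at hv hv'
    exact S.disjoint hO hd hef hv hv'
  have hDedge : ∀ e f, e ≠ f → (D e).edge (l e) ≠ (D f).edge (l f) := fun e f hef h =>
    hef (Subtype.ext (by rw [← hDe e, ← hDe f, h]))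
  have hXdisj : ∀ e f, e ≠ f → Disjoint (X e) (X f) := by
    intro e f hef
    rw [Finset.disjoint_left]
    intro v hv hv'
    rw [hX, OddCycle.mem_vset] at hv hv'
    exact (hD e).disjoint (hD f) hO hd (hDedge e f hef) hv hv'
  have hmain := sum_le_two_mul_card_edges (G := G) Z X hZdisj hXdisj
  rw [← hW] at hmain
  -- A tight cycle falls short of `3 g + 2` by at most two, which it obtains from its partner.
  set tight : {e // e ∈ uncolored G c} → Prop := fun e => ∃ i₀, S.Tight g e i₀ with htight
  have hpartner : ∀ e, ∃ f, tight e → e ≠ f ∧ (S.cyc f).L ≠ g ∧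
      ∃ i₀, S.Tight g e i₀ ∧ ∀ i, i ≠ i₀ → S.Joined e i f := by
    intro e
    by_cases he : tight e
    · obtain ⟨i₀, hi₀⟩ := he
      obtain ⟨f, hef, hf⟩ := hi₀.exists_partner hO hd
      exact ⟨f, fun _ => ⟨hef, fun h => hP.false (hi₀.petersen hG hc hd hg hef hf h).some,
        i₀, hi₀, hf⟩⟩
    · exact ⟨e, fun h => absurd h he⟩
  choose π hπ using hpartner
  set K : {e // e ∈ uncolored G c} → Finset {e // e ∈ uncolored G c} := fun f =>
    (Finset.univ.filter tight).filter fun e => π e = f with hK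
  have hKsum : ∑ f, (K f).card = (Finset.univ.filter tight).card :=
    (Finset.card_eq_sum_card_fiberwise fun _ _ => Finset.mem_coe.2 (Finset.mem_univ _)).symm
  have hKmem : ∀ f e, e ∈ K f ↔ tight e ∧ π e = f := fun f e => by
    rw [hK, Finset.mem_filter, Finset.mem_filter]; simp
  -- The balance of a single cycle after the discharging.
  have hlocal : ∀ e, 3 * g + 2 + 2 * (K e).card ≤ (∑ v ∈ Z e, G.degree v +
      (entering G W (X e)).card) + 2 * (if tight e then 1 else 0) := by
    intro e
    have hs : ∑ v ∈ Z e, G.degree v + (S.cyc e).degTwo.card = 3 * (S.cyc e).L :=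
      (S.cyc e).sum_degree hd
    have hLg := (S.cyc e).le_length hg
    have hmg := (D e).le_length hg
    have hb : (S.cyc e).degTwo.card ≠ 0 →
        2 * ((D e).vset \ (S.cyc e).vset).card ≤ (entering G W (X e)).card := by
      intro h0
      refine (D e).two_mul_le_card_entering Finset.sdiff_subset ?_
      intro v hv hvW
      rw [Finset.mem_sdiff, OddCycle.mem_vset, OddCycle.mem_vset] at hv
      obtain ⟨f, hf⟩ := (hmemW v).1 hvW
      rcases eq_or_ne e f with rfl | hef
      · exact hv.2 hf
      · refine (hD e).disjoint (S.alt f) hO hd ?_ hv.1 hf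
        rw [hDe, S.edge_eq]
        exact fun h => hef (Subtype.ext h)
    -- A cycle of length `g` is not a partner, as the graph is not the Petersen graph.
    by_cases hL : (S.cyc e).L = g
    · have hK0 : (K e).card = 0 := by
        rw [Finset.card_eq_zero, Finset.eq_empty_iff_forall_notMem]
        intro e' he'
        obtain ⟨h1, h2⟩ := (hKmem _ _).1 he'
        have := (hπ e' h1).2.1
        rw [h2] at this
        exact this hL
      have hge : OddWalksGE G (S.cyc e).L := by rwa [hL]
      by_cases h0 : (S.cyc e).degTwo.card = 0
      · by_cases ht : tight e
        · rw [if_pos ht]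
          omega
        · -- A cycle that is not tight is entered from outside at two vertices.
          have hdeg : ∀ i, G.degree ((S.cyc e).z i) = 3 := by
            intro i
            have h1 := hd ((S.cyc e).z i)
            rw [Finset.card_eq_zero, Finset.eq_empty_iff_forall_notMem] at h0
            have h2 := h0 i
            rw [OddCycle.degTwo, Finset.mem_filter] at h2
            simp only [Finset.mem_univ, true_and] at h2
            omega
          set I : Finset (ZMod (S.cyc e).L) :=
            Finset.univ.filter fun i => ¬ ∃ f, e ≠ f ∧ S.Joined e i f with hI
          have hI2 : 2 ≤ I.card := by
            by_contra hcon
            obtain ⟨i₀, hi₀⟩ := Finset.card_le_one_iff_subset_singleton.1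
              (by omega : I.card ≤ 1)
            refine ht ⟨i₀, hL, hdeg, fun i hi => ?_⟩
            by_contra hni
            have : i ∈ I := by rw [hI, Finset.mem_filter]; exact ⟨Finset.mem_univ _, hni⟩
            exact hi (Finset.mem_singleton.1 (hi₀ this))
          have hIB : I.card ≤ (entering G W (X e)).card := by
            have : X e = (S.cyc e).vset := by rw [hX]; simp only [hD0 e h0]
            rw [this]
            refine (S.cyc e).card_le_card_entering fun i hi => ?_
            obtain ⟨w, hw, hw1, hw2⟩ := (S.cyc e).exists_stub (hdeg i)
            refine ⟨w, fun hwW => ?_, hw⟩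
            rw [hI, Finset.mem_filter] at hi
            obtain ⟨f, hf⟩ := (hmemW w).1 hwW
            rcases eq_or_ne e f with rfl | hef
            · exact OddCycle.stub_notMem hge hw hw1 hw2 hf
            · obtain ⟨k, rfl⟩ := hf
              exact hi.2 ⟨f, hef, k, hw⟩
          omega
      · obtain ⟨h1, h2⟩ := hD1 e h0
        have h2 := h2 hge
        have h3 := hb h0
        omega
    · have hoddL := (S.cyc e).odd
      rw [Nat.odd_iff] at hoddL hodd
      have hk : (K e).card * (g - 1) + 2 * (S.cyc e).degTwo.card ≤ (S.cyc e).L := by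
        refine CycleSystem.card_mul_le_length hO hd fun e' he' => ?_
        obtain ⟨h1, h2⟩ := (hKmem _ _).1 he'
        have := hπ e' h1
        rw [h2] at this
        exact ⟨this.1, this.2.2⟩
      have := discharge_long hg3 (by omega : g + 2 ≤ (S.cyc e).L) hk hs
        (fun h0 => ⟨hb h0, hmg, (hD1 e h0).1⟩)
      omega
  have hT : ∑ e, (if tight e then 1 else 0) = (Finset.univ.filter tight).card :=
    (Finset.card_filter tight Finset.univ).symm
  -- The transfers cancel in the sum over all cycles.
  have hsum := Finset.sum_le_sum fun e (_ : e ∈ Finset.univ) => hlocal e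
  rw [Finset.sum_add_distrib, Finset.sum_add_distrib (g := fun e => 2 * (if tight e then 1 else 0)),
    ← Finset.mul_sum, ← Finset.mul_sum, hKsum, hT, Finset.sum_const,
    Finset.card_univ, Fintype.card_coe, smul_eq_mul] at hsum
  omega

end ThreeColoring

/-! ### From partial colourings to subgraphs -/

namespace ThreeColoring
variable {V : Type*} [Fintype V] [DecidableEq V] {G : SimpleGraph V} [DecidableRel G.Adj]
  {c : Sym2 V → Option (Fin 3)}

lemma ncard_edgeSet : G.edgeSet.ncard = G.edgeFinset.card := by
  rw [← SimpleGraph.coe_edgeFinset, Set.ncard_coe_finset]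

lemma maxThreeColoredEdges_le : maxThreeColoredEdges G ≤ G.edgeFinset.card := by
  rw [← ncard_edgeSet]
  refine csSup_le' ?_
  rintro n ⟨H, hH, -, rfl⟩
  exact Set.ncard_le_ncard (SimpleGraph.edgeSet_mono hH) (Set.toFinite _)

/-- The coloured edges of a proper partial colouring form a 3-edge-colourable subgraph. -/
lemma IsProper.card_le (hc : IsProper G c) :
    G.edgeFinset.card ≤ maxThreeColoredEdges G + (uncolored G c).card := by
  set E : Finset (Sym2 V) := G.edgeFinset \ uncolored G c with hE
  set H : SimpleGraph V := SimpleGraph.fromEdgeSet (E : Set (Sym2 V)) with hH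
  have hmem : ∀ e, e ∈ E ↔ e ∈ G.edgeSet ∧ c e ≠ none := fun e => by
    rw [hE, Finset.mem_sdiff, SimpleGraph.mem_edgeFinset, mem_uncolored]; tauto
  have hHE : H.edgeSet = E := by
    rw [hH, SimpleGraph.edgeSet_fromEdgeSet, sdiff_eq_left, Set.disjoint_left]
    intro e he
    exact G.not_isDiag_of_mem_edgeSet ((hmem e).1 he).1
  have hle : H ≤ G := by
    rw [← SimpleGraph.edgeSet_subset_edgeSet, hHE]
    exact fun e he => ((hmem e).1 he).1
  have hcol : EdgeColorable H 3 := by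
    have hsome : ∀ e : H.edgeSet, ∃ k, c e = some k := fun e =>
      Option.ne_none_iff_exists'.1 ((hmem e).1 (by rw [← Finset.mem_coe, ← hHE]; exact e.2)).2
    choose k hk using hsome
    refine ⟨SimpleGraph.Coloring.mk k ?_⟩
    intro e f hef hkk
    rw [SimpleGraph.lineGraph_adj_iff_exists] at hef
    obtain ⟨hne, v, hv, hv'⟩ := hef
    obtain ⟨x, hx⟩ := Sym2.mem_iff_exists.1 hv
    obtain ⟨y, hy⟩ := Sym2.mem_iff_exists.1 hv'
    have hex : G.Adj v x := hle (by rw [← SimpleGraph.mem_edgeSet, ← hx]; exact e.2)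
    have hfy : G.Adj v y := hle (by rw [← SimpleGraph.mem_edgeSet, ← hy]; exact f.2)
    have hxy : x = y := hc hex hfy (by rw [← hx, hk]) (by rw [← hy, hk, hkk])
    exact hne (Subtype.ext (by rw [hx, hy, hxy]))
  have hbdd : BddAbove {n : ℕ | ∃ H : SimpleGraph V, H ≤ G ∧ EdgeColorable H 3 ∧
      H.edgeSet.ncard = n} := by
    refine ⟨G.edgeSet.ncard, ?_⟩
    rintro n ⟨H, hH, -, rfl⟩
    exact Set.ncard_le_ncard (SimpleGraph.edgeSet_mono hH) (Set.toFinite _)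
  have hmax : E.card ≤ maxThreeColoredEdges G :=
    le_csSup hbdd ⟨H, hle, hcol, by rw [hHE, Set.ncard_coe_finset]⟩
  exact Finset.card_le_card_sdiff_add_card.trans (Nat.add_le_add_right hmax _)

/-- If the odd girth is finite, it is the length of a cycle. -/
lemma odd_and_three_le_of_oddGirth_eq {g : ℕ} (hg : oddGirth G = g) : Odd g ∧ 3 ≤ g := by
  have : ∃ (a : V) (w : G.Walk a a), w.IsCycle ∧ Odd w.length ∧ w.length ≤ g := by
    by_contra! h
    have : ((g + 1 : ℕ) : ℕ∞) ≤ oddGirth G :=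
      le_iInf fun a => le_iInf fun w => le_iInf fun h1 => le_iInf fun h2 =>
        Nat.cast_le.2 (h a w h1 h2)
    rw [hg, Nat.cast_le] at this
    omega
  obtain ⟨a, w, h1, h2, h3⟩ := this
  have h4 := oddGirth_le_of_odd w h2
  rw [hg, Nat.cast_le] at h4
  obtain rfl : w.length = g := le_antisymm h3 h4
  exact ⟨h2, h1.three_le_length⟩

lemma oddWalksGE_of_oddGirth_eq {g : ℕ} (hg : oddGirth G = g) : OddWalksGE G g := fun v w hw => by
  have := oddGirth_le_of_odd w hw
  rwa [hg, Nat.cast_le] at this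

/-- In a graph without odd cycles an optimal colouring leaves no edge uncoloured. -/
lemma IsOptimal.uncolored_eq_empty (hc : IsOptimal G c) (hd : ∀ v, G.degree v ≤ 3)
    (hg : oddGirth G = ⊤) : uncolored G c = ∅ := by
  rw [Finset.eq_empty_iff_forall_notMem]
  intro e he
  obtain ⟨C, -⟩ := hc.exists_alternating_of_mem hd he
  obtain ⟨w, hw⟩ : ∃ w : G.Walk (C.z 0) (C.z 0), w.length = C.L := by
    have := C.exists_walk 0 C.L
    rwa [ZMod.natCast_self, add_zero] at this
  have := oddGirth_le_of_odd w (by rw [hw]; exact C.odd)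
  rw [hg, top_le_iff] at this
  exact ENat.natCast_ne_top _ this

end ThreeColoring

open ThreeColoring in
theorem theorem1 {V : Type*} [Fintype V] (G : SimpleGraph V) [DecidableRel G.Adj]
    (hconn : G.Connected) (hdeg : G.maxDegree = 3) (hP : IsEmpty (G ≃g petersenGraph)) :
    (∀ g : ℕ, oddGirth G = (g : ℕ∞) →
      1 - 2 / (3 * (g : ℝ) + 2) ≤ coloredFraction G) ∧
    (oddGirth G = ⊤ → coloredFraction G = 1) ∧
    (5 ≤ oddGirth G → 15 / 17 ≤ coloredFraction G) := by
  classical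
  have hd : ∀ v, G.degree v ≤ 3 := fun v => hdeg ▸ G.degree_le_maxDegree v
  obtain ⟨c, hc⟩ := exists_isExtremal (G := G)
  have hcard := hc.1.1.card_le
  have hE : (0 : ℝ) < G.edgeFinset.card := by
    have := hconn.nonempty
    obtain ⟨v, hv⟩ := G.exists_maximal_degree_vertex
    obtain ⟨w, hw⟩ := (G.degree_pos_iff_exists_adj v).1 (by omega)
    exact Nat.cast_pos.2 (Finset.card_pos.2 ⟨s(v, w), G.mem_edgeFinset.2 hw⟩)
  have hfinite : ∀ g : ℕ, oddGirth G = (g : ℕ∞) →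
      1 - 2 / (3 * (g : ℝ) + 2) ≤ coloredFraction G := by
    intro g hg
    obtain ⟨hodd, hg3⟩ := odd_and_three_le_of_oddGirth_eq hg
    have h := hc.card_mul_le hconn hd hP (oddWalksGE_of_oddGirth_eq hg) hodd hg3
    have h' : ((uncolored G c).card : ℝ) * (3 * g + 2) ≤ 2 * G.edgeFinset.card := by
      exact_mod_cast h
    have hcard' : (G.edgeFinset.card : ℝ) ≤ maxThreeColoredEdges G + (uncolored G c).card := by
      exact_mod_cast hcard
    have hg0 : (0 : ℝ) < 3 * g + 2 := by positivity
    rw [coloredFraction, ncard_edgeSet, le_div_iff₀ hE, sub_mul, one_mul, div_mul_eq_mul_div]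
    have := (le_div_iff₀ hg0).2 h'
    linarith
  have htop : oddGirth G = ⊤ → coloredFraction G = 1 := by
    intro hg
    rw [hc.1.uncolored_eq_empty hd hg, Finset.card_empty, add_zero] at hcard
    rw [coloredFraction, ncard_edgeSet, le_antisymm maxThreeColoredEdges_le hcard,
      div_self hE.ne']
  refine ⟨hfinite, htop, fun h5 => ?_⟩
  rcases eq_or_ne (oddGirth G) ⊤ with h | h
  · rw [htop h]; norm_num
  · obtain ⟨g, hg⟩ := ENat.ne_top_iff_exists.1 h
    refine le_trans ?_ (hfinite g hg.symm)
    rw [← hg] at h5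
    have h5' : (5 : ℝ) ≤ g := by exact_mod_cast h5
    have : 2 / (3 * (g : ℝ) + 2) ≤ 2 / 17 := by gcongr; linarith
    linarith
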